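/- Let $n\geq 3$. Let $B_n$ be the Artin braid group on $n$ strings, that is, the group with generators $\sigma_1,\ldots,\sigma_{n-1}$ and relations $\sigma_i\sigma_j=\sigma_j\sigma_i$ for $|i-j|\geq 2$ and $\sigma_{i+1}\sigma_i\sigma_{i+1}=\sigma_i\sigma_{i+1}\sigma_i$ for $1\leq i\leq n-2$. Let $P_n$ be the pure braid group, that is, the kernel of the homomorphism $B_n\to S_n$ to the symmetric group that sends $\sigma_i$ to the transposition $(i,i+1)$ for each $i$, and let $\Gamma_3(P_n)=[P_n,[P_n,P_n]]$ be the third term of the lower central series of $P_n$, which is a normal subgroup of $B_n$. Then there is a one-to-one correspondence between the isomorphism classes of the finite Abelian subgroups of $B_n/\Gamma_3(P_n)$ and the isomorphism classes of the finite Abelian subgroups of $S_n$ whose order is relatively prime to $6$; more precisely, there is a bijection between these two sets of isomorphism classes under which the class of $H\leq B_n/\Gamma_3(P_n)$ corresponds to the class of $K\leq S_n$ if and only if $H\cong K$. -/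

import Mathlib

/-- The defining relators of the Artin braid group on `n` strings. The generator with index
`i : Fin (n - 1)` is the usual `σ_{i+1}`. -/
def braidRels (n : ℕ) : Set (FreeGroup (Fin (n - 1))) :=
  {r | (∃ i j : Fin (n - 1), i.val + 2 ≤ j.val ∧
          r = (FreeGroup.of i * FreeGroup.of j) * (FreeGroup.of j * FreeGroup.of i)⁻¹) ∨
       (∃ i j : Fin (n - 1), i.val + 1 = j.val ∧
          r = (FreeGroup.of j * FreeGroup.of i * FreeGroup.of j) *
              (FreeGroup.of i * FreeGroup.of j * FreeGroup.of i)⁻¹)}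

/-- The Artin braid group `B_n`, by the Artin presentation. -/
abbrev BraidGroup (n : ℕ) : Type := PresentedGroup (braidRels n)

/-- The adjacent transposition attached to the generator with index `i`. -/
def adjSwap (n : ℕ) (i : Fin (n - 1)) : Equiv.Perm (Fin n) :=
  Equiv.swap ⟨i.val, by omega⟩ ⟨i.val + 1, by omega⟩

theorem adjSwap_rels (n : ℕ) : ∀ r ∈ braidRels n, FreeGroup.lift (adjSwap n) r = 1 := by
  rintro r (⟨i, j, hij, rfl⟩ | ⟨i, j, hij, rfl⟩)
  · simp only [map_mul, map_inv, FreeGroup.lift_apply_of, mul_inv_eq_one]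
    ext x
    simp only [adjSwap, Equiv.Perm.mul_apply, Equiv.swap_apply_def, Fin.ext_iff]
    grind
  · simp only [map_mul, map_inv, FreeGroup.lift_apply_of, mul_inv_eq_one]
    ext x
    simp only [adjSwap, Equiv.Perm.mul_apply, Equiv.swap_apply_def, Fin.ext_iff]
    grind

/-- The homomorphism `σ : B_n → S_n` sending each Artin generator to the corresponding adjacent
transposition. -/
def braidPerm (n : ℕ) : BraidGroup n →* Equiv.Perm (Fin n) :=
  PresentedGroup.toGroup (adjSwap_rels n)

/-- The pure braid group `P_n`. -/
def pureBraidGroup (n : ℕ) : Subgroup (BraidGroup n) := (braidPerm n).ker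

instance pureBraidGroup_normal (n : ℕ) : (pureBraidGroup n).Normal :=
  MonoidHom.normal_ker _

/-- `Γ_3(P_n) = [[P_n, P_n], P_n]`, as a subgroup of `B_n`. Mathlib indexes the lower central
series from `0`, so that `Γ_3` has index `2`. -/
def gammaThreePure (n : ℕ) : Subgroup (BraidGroup n) :=
  (pureBraidGroup n).lowerCentralSeries 2

instance gammaThreePure_normal (n : ℕ) : (gammaThreePure n).Normal := by
  unfold gammaThreePure
  rw [Subgroup.lowerCentralSeries_succ, Subgroup.lowerCentralSeries_succ,
    Subgroup.lowerCentralSeries_zero]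
  infer_instance

/-- The group `B_n / Γ_3(P_n)`. -/
abbrev BraidModGammaThree (n : ℕ) : Type := BraidGroup n ⧸ gammaThreePure n

/-- `H` is a finite Abelian subgroup. -/
def IsFiniteAbelian {G : Type} [Group G] (H : Subgroup G) : Prop :=
  Finite H ∧ IsMulCommutative H

/-- Isomorphism, as an equivalence relation on the subgroups of `G` with property `p`. -/
def subgroupIsoSetoid {G : Type} [Group G] (p : Subgroup G → Prop) :
    Setoid {H : Subgroup G // p H} where
  r H K := Nonempty (H.1 ≃* K.1)
  iseqv :=
    { refl := fun _ => ⟨MulEquiv.refl _⟩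
      symm := fun ⟨e⟩ => ⟨e.symm⟩
      trans := fun ⟨e⟩ ⟨f⟩ => ⟨e.trans f⟩ }

/-- The set of isomorphism classes of the subgroups of `G` with property `p`. -/
def SubgroupIsoClasses {G : Type} [Group G] (p : Subgroup G → Prop) : Type :=
  Quotient (subgroupIsoSetoid p)

/-- The isomorphism class of a subgroup with property `p`. -/
def subgroupIsoClass {G : Type} [Group G] {p : Subgroup G → Prop}
    (H : {H : Subgroup G // p H}) : SubgroupIsoClasses p :=
  Quotient.mk (subgroupIsoSetoid p) H

/-! The group `B_n / Γ_3(P_n)` is an extension of `S_n` by `P_n / Γ_3(P_n)`, and everything follows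
from an explicit faithful model of it. `TripleGroup` consists of integer functions on pairs and
triples of indices together with a permutation. The `v` part records the abelianization of `P_n`,
with one class for each pair of strings; the `w` part records `Γ_2 / Γ_3`, with one class for each
triple. The map `modTriple` is injective because suitable generators of these two layers go to `2`
and `24` times basis vectors (`modTriple_injective`). Hence `P_n / Γ_3(P_n)` is torsion free, and a
finite subgroup is isomorphic to its image in `S_n`.

Elements of order `2` and `3` are excluded by congruences. In the image of the braid group, `v`
modulo `2` and `w` modulo `3` are determined by the permutation (`inversionSubgroup`). If `g ^ 2 =
1` and `g` exchanges two points, `v` would vanish there, against the parity; if `g ^ 3 = 1` and `g`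
rotates three points, `w` would be divisible by `3` there, against the residue. By Cauchy, finite
subgroups have order prime to `6`.

Conversely, for `q` prime to `6` the rotation of `q` points lifts to an element of order `q`
(`exists_rotation_lift`): the `q`-th power of any lift is killed by correcting the lift first on
pairs, then on triples, with `2` and `3` invertible modulo `q`. Lifts on disjoint blocks of strings
commute, so a product of such cyclic groups of total order at most `n` embeds
(`exists_injective_of_sum_le`). A commutative `K ≤ S_n` embeds in a product of this kind by its
action on its orbits (`exists_injective_prod_cyclic`). -/

open scoped commutatorElement

/-! ### The model group of functions on pairs and triples. -/

/-- The cyclic alternating pairing of two functions on pairs, with values in functions on triples. -/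
def triplePairing {ι : Type} (v v' : ι → ι → ℤ) (i j k : ι) : ℤ :=
  v i j * v' j k - v j k * v' i j + (v j k * v' k i - v k i * v' j k) +
    (v k i * v' i j - v i j * v' k i)

/-- A class-two nilpotent group of functions on pairs and triples of indices, extended by the
permutations of the indices. -/
@[ext]
structure TripleGroup (ι : Type) where
  /-- the value on pairs -/
  v : ι → ι → ℤ
  /-- the value on triples -/
  w : ι → ι → ι → ℤ
  /-- the permutation -/
  s : Equiv.Perm ι

namespace TripleGroup

variable {ι : Type}

instance : Mul (TripleGroup ι) where
  mul g h :=
    { v := fun i j => g.v i j + h.v (g.s⁻¹ i) (g.s⁻¹ j)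
      -- The factor `3` makes `w` modulo `3` additive up to the permutation action, and it makes the
      -- coefficient in `genTriple` an integer.
      w := fun i j k => g.w i j k + h.w (g.s⁻¹ i) (g.s⁻¹ j) (g.s⁻¹ k) +
        3 * triplePairing g.v (fun i j => h.v (g.s⁻¹ i) (g.s⁻¹ j)) i j k
      s := g.s * h.s }

instance : One (TripleGroup ι) where
  one := ⟨fun _ _ => 0, fun _ _ _ => 0, 1⟩

instance : Inv (TripleGroup ι) where
  inv g := ⟨fun i j => -g.v (g.s i) (g.s j), fun i j k => -g.w (g.s i) (g.s j) (g.s k), g.s⁻¹⟩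

theorem mul_v (g h : TripleGroup ι) (i j : ι) :
    (g * h).v i j = g.v i j + h.v (g.s⁻¹ i) (g.s⁻¹ j) := rfl

theorem mul_w (g h : TripleGroup ι) (i j k : ι) :
    (g * h).w i j k = g.w i j k + h.w (g.s⁻¹ i) (g.s⁻¹ j) (g.s⁻¹ k) +
      3 * triplePairing g.v (fun i j => h.v (g.s⁻¹ i) (g.s⁻¹ j)) i j k := rfl

@[simp] theorem mul_s (g h : TripleGroup ι) : (g * h).s = g.s * h.s := rfl
@[simp] theorem one_v (i j : ι) : (1 : TripleGroup ι).v i j = 0 := rfl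
@[simp] theorem one_w (i j k : ι) : (1 : TripleGroup ι).w i j k = 0 := rfl
@[simp] theorem one_s : (1 : TripleGroup ι).s = 1 := rfl

theorem inv_v (g : TripleGroup ι) (i j : ι) : g⁻¹.v i j = -g.v (g.s i) (g.s j) := rfl

theorem inv_w (g : TripleGroup ι) (i j k : ι) :
    g⁻¹.w i j k = -g.w (g.s i) (g.s j) (g.s k) := rfl

@[simp] theorem inv_s (g : TripleGroup ι) : g⁻¹.s = g.s⁻¹ := rfl

instance : Group (TripleGroup ι) :=
  Group.ofLeftAxioms
    (fun a b c => by
      ext i j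
      · simp only [mul_v, mul_s, mul_inv_rev, Equiv.Perm.mul_apply]; ring
      · simp only [mul_w, mul_v, mul_s, mul_inv_rev, Equiv.Perm.mul_apply, triplePairing]; ring
      · rfl)
    (fun a => by
      ext i j
      · simp [mul_v]
      · simp [mul_w, triplePairing]
      · simp)
    (fun a => by
      ext i j
      · simp [mul_v, inv_v]
      -- The quadratic term vanishes because the pairing of a function with itself is zero.
      · simp [mul_w, inv_w, inv_v, triplePairing]; ring
      · simp)

/-- The projection to the permutations. -/
def perm : TripleGroup ι →* Equiv.Perm ι where
  toFun := s
  map_one' := rfl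
  map_mul' _ _ := rfl

@[simp] theorem perm_apply (g : TripleGroup ι) : perm g = g.s := rfl

/-- The elements whose pair values are symmetric and whose triple values are alternating. -/
def alternatingSubgroup (ι : Type) : Subgroup (TripleGroup ι) where
  carrier := {g | (∀ i j, g.v i j = g.v j i) ∧ (∀ i, g.v i i = 0) ∧
    (∀ i j k, g.w i j k = -g.w j i k) ∧ ∀ i j k, g.w i j k = -g.w i k j}
  one_mem' := by simp
  mul_mem' := by
    rintro g h ⟨g1, g2, g3, g4⟩ ⟨h1, h2, h3, h4⟩
    refine ⟨fun i j => ?_, fun i => ?_, fun i j k => ?_, fun i j k => ?_⟩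
    · rw [mul_v, mul_v, g1 i j, h1]
    · rw [mul_v, g2, h2, add_zero]
    · rw [mul_w, mul_w, g3 i j k, h3 _ (g.s⁻¹ j) _]
      simp only [triplePairing]
      rw [g1 j i, g1 i k, g1 k j, h1 (g.s⁻¹ j) (g.s⁻¹ i), h1 (g.s⁻¹ i) (g.s⁻¹ k),
        h1 (g.s⁻¹ k) (g.s⁻¹ j)]
      ring
    · rw [mul_w, mul_w, g4 i j k, h4 _ (g.s⁻¹ j) _]
      simp only [triplePairing]
      rw [g1 j i, g1 i k, g1 k j, h1 (g.s⁻¹ j) (g.s⁻¹ i), h1 (g.s⁻¹ i) (g.s⁻¹ k),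
        h1 (g.s⁻¹ k) (g.s⁻¹ j)]
      ring
  inv_mem' := by
    rintro g ⟨g1, g2, g3, g4⟩
    refine ⟨fun i j => ?_, fun i => ?_, fun i j k => ?_, fun i j k => ?_⟩
    · rw [inv_v, inv_v, g1]
    · rw [inv_v, g2, neg_zero]
    · rw [inv_w, inv_w, g3]
    · rw [inv_w, inv_w, g4]

/-- The sign of the position of the maximum in a triple: `1` if it is first, `-1` if it is second,
and `0` if it is third. -/
def maxSign {ι : Type} [LinearOrder ι] (i j k : ι) : ZMod 3 :=
  (if j < i ∧ k < i then 1 else 0) - (if i < j ∧ k < j then 1 else 0)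

/-- The elements whose pair values modulo `2` are measured by the inversions of the permutation,
and whose triple values modulo `3` are measured by its action on the order of triples. -/
def inversionSubgroup (ι : Type) [LinearOrder ι] : Subgroup (TripleGroup ι) where
  carrier := {g | (∀ i j, i ≠ j → (g.v i j : ZMod 2) =
        (if i < j then 1 else 0) - (if g.s⁻¹ i < g.s⁻¹ j then 1 else 0)) ∧
      ∀ i j k, i ≠ j → j ≠ k → i ≠ k → (g.w i j k : ZMod 3) =
        maxSign i j k - maxSign (g.s⁻¹ i) (g.s⁻¹ j) (g.s⁻¹ k)}
  one_mem' :=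
    ⟨fun i j _ => by rw [one_s, inv_one, Equiv.Perm.one_apply, Equiv.Perm.one_apply]; simp,
      fun i j k _ _ _ => by
        rw [one_s, inv_one, Equiv.Perm.one_apply, Equiv.Perm.one_apply, Equiv.Perm.one_apply]
        simp⟩
  mul_mem' := by
    rintro g h ⟨g1, g2⟩ ⟨h1, h2⟩
    refine ⟨fun i j hij => ?_, fun i j k hij hjk hik => ?_⟩
    · rw [mul_v, Int.cast_add, g1 i j hij, h1 _ _ (by simpa using hij)]
      simp
    -- Modulo `3` the pairing term disappears, and the differences of `maxSign` telescope.
    · have h3 : (3 : ZMod 3) = 0 := rfl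
      rw [mul_w, Int.cast_add, Int.cast_add, g2 i j k hij hjk hik,
        h2 _ _ _ (by simpa using hij) (by simpa using hjk) (by simpa using hik)]
      push_cast
      simp only [h3, mul_s, mul_inv_rev, Equiv.Perm.mul_apply]
      ring
  inv_mem' := by
    rintro g ⟨g1, g2⟩
    refine ⟨fun i j hij => ?_, fun i j k hij hjk hik => ?_⟩
    · rw [inv_v, Int.cast_neg, g1 _ _ (by simpa using hij)]
      simp
    · rw [inv_w, Int.cast_neg, g2 _ _ _ (by simpa using hij) (by simpa using hjk)
        (by simpa using hik)]
      simp

/-- Conjugation of an element with trivial permutation, on pairs. -/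
theorem conj_v (g h : TripleGroup ι) (hs : h.s = 1) (i j : ι) :
    (g * h * g⁻¹).v i j = h.v (g.s⁻¹ i) (g.s⁻¹ j) := by
  simp [mul_v, inv_v, hs]

theorem conj_w (g h : TripleGroup ι) (hs : h.s = 1) (hv : ∀ i j, h.v i j = 0) (i j k : ι) :
    (g * h * g⁻¹).w i j k = h.w (g.s⁻¹ i) (g.s⁻¹ j) (g.s⁻¹ k) := by
  simp [mul_w, mul_v, inv_w, inv_v, hs, hv, triplePairing]; ring

theorem commutator_v (g h : TripleGroup ι) (gs : g.s = 1) (hs : h.s = 1) (i j : ι) :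
    ⁅g, h⁆.v i j = 0 := by
  simp [commutatorElement_def, mul_v, inv_v, hs, gs]

/-- The pairing is antisymmetric in its two arguments, so the commutator doubles the factor `3`. -/
theorem commutator_w (g h : TripleGroup ι) (gs : g.s = 1) (hs : h.s = 1) (i j k : ι) :
    ⁅g, h⁆.w i j k = 6 * triplePairing g.v h.v i j k := by
  simp [commutatorElement_def, mul_w, mul_v, inv_w, inv_v, hs, gs, triplePairing]; ring

/-- The kernel of the projection to the permutations has nilpotency class at most two. -/
theorem commutator_commutator_ker_perm :
    ⁅⁅(perm (ι := ι)).ker, (perm (ι := ι)).ker⁆, (perm (ι := ι)).ker⁆ = ⊥ := by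
  have key : ⁅(perm (ι := ι)).ker, (perm (ι := ι)).ker⁆ ≤
      Subgroup.centralizer ((perm (ι := ι)).ker : Set (TripleGroup ι)) := by
    rw [Subgroup.commutator_le]
    intro g hg h hh
    rw [MonoidHom.mem_ker, perm_apply] at hg hh
    rw [Subgroup.mem_centralizer_iff]
    intro x hx
    rw [SetLike.mem_coe, MonoidHom.mem_ker, perm_apply] at hx
    have hs : ⁅g, h⁆.s = 1 := by simp [commutatorElement_def, hg, hh]
    have hv := commutator_v g h hg hh
    ext i j
    · simp [mul_v, hv, hx, hs]
    · simp [mul_w, hv, hx, hs, triplePairing]; ring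
    · simp [hx, hs]
  rwa [Subgroup.commutator_eq_bot_iff_le_centralizer]

end TripleGroup

open TripleGroup

/-! ### The homomorphism from the braid group to the model. -/

theorem adjSwap_inv (n : ℕ) (i : Fin (n - 1)) : (adjSwap n i)⁻¹ = adjSwap n i :=
  Equiv.swap_inv _ _

theorem adjSwap_val (n : ℕ) (i : Fin (n - 1)) (x : Fin n) :
    (adjSwap n i x).val =
      if x.val = i.val then i.val + 1 else if x.val = i.val + 1 then i.val else x.val := by
  simp only [adjSwap, Equiv.swap_apply_def, Fin.ext_iff]
  split_ifs <;> rfl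

/-- The pair value of a braid generator: the symmetric indicator of `{i, i + 1}`. -/
def genPair (a x y : ℕ) : ℤ :=
  if x = a ∧ y = a + 1 ∨ x = a + 1 ∧ y = a then 1 else 0

/-- The antisymmetric indicator of `(a, a + 1)`. -/
def genAnti (a x y : ℕ) : ℤ :=
  if x = a ∧ y = a + 1 then 1 else if x = a + 1 ∧ y = a then -1 else 0

/-- The triple value of a braid generator. -/
def genTriple (a x y z : ℕ) : ℤ :=
  -- The braid relation forces the coefficient: with `c` in place of `-2`, its two sides take the
  -- values `-c - 3` and `2 * c + 3` on the triple of strings involved.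
  -2 * ((if x < a then genAnti a y z else 0) + (if y < a then genAnti a z x else 0) +
    (if z < a then genAnti a x y else 0))

/-- The image of a braid generator in the group of functions on pairs and triples. -/
def tripleGen (n : ℕ) (i : Fin (n - 1)) : TripleGroup (Fin n) where
  v x y := genPair i x y
  w x y z := genTriple i x y z
  s := adjSwap n i

/-- The transposition `(a, a + 1)` on the natural numbers. -/
def natAdjSwap (a x : ℕ) : ℕ := if x = a then a + 1 else if x = a + 1 then a else x

/-- The pair value of a word in the braid generators. -/
def wordPair : List ℕ → ℕ → ℕ → ℤ
  | [], _, _ => 0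
  | a :: l, x, y => genPair a x y + wordPair l (natAdjSwap a x) (natAdjSwap a y)

/-- The triple value of a word in the braid generators. -/
def wordTriple : List ℕ → ℕ → ℕ → ℕ → ℤ
  | [], _, _, _ => 0
  | a :: l, x, y, z =>
    genTriple a x y z + wordTriple l (natAdjSwap a x) (natAdjSwap a y) (natAdjSwap a z) +
      3 * triplePairing (genPair a)
        (fun x y => wordPair l (natAdjSwap a x) (natAdjSwap a y)) x y z

theorem list_prod_tripleGen {n : ℕ} (l : List (Fin (n - 1))) (x y z : Fin n) :
    (l.map (tripleGen n)).prod.v x y = wordPair (l.map Fin.val) x y ∧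
      (l.map (tripleGen n)).prod.w x y z = wordTriple (l.map Fin.val) x y z := by
  have val : ∀ (i : Fin (n - 1)) (x : Fin n), (adjSwap n i x).val = natAdjSwap i x :=
    fun i x => adjSwap_val n i x
  induction l generalizing x y z with
  | nil => exact ⟨rfl, rfl⟩
  | cons a l ih =>
    have hs : (tripleGen n a).s⁻¹ = adjSwap n a := adjSwap_inv n a
    have h1 := fun x y => (ih x y x).1
    have h2 := fun x y z => (ih x y z).2
    constructor
    · rw [List.map_cons, List.prod_cons, mul_v, hs, h1, val, val]
      rfl
    · rw [List.map_cons, List.prod_cons, mul_w, hs, h2, val, val, val]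
      simp only [h1, val]
      rfl

/-- `x` and `x'` have the same position relative to `a, a + 1` and `a', a' + 1`. -/
def SamePosition (a a' x x' : ℕ) : Prop :=
  (x = a ↔ x' = a') ∧ (x = a + 1 ↔ x' = a' + 1) ∧ (x < a ↔ x' < a')

/-- The values of a word depend on the indices only through their comparison with the letters. This
reduces the braid relations for every `n` to a check on finitely many positions. -/
theorem word_congr (R : ℕ → ℕ → Prop) (L : List (ℕ × ℕ))
    (hR : ∀ p ∈ L, ∀ x x', R x x' →
      SamePosition p.1 p.2 x x' ∧ R (natAdjSwap p.1 x) (natAdjSwap p.2 x'))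
    {x y z x' y' z' : ℕ} (hx : R x x') (hy : R y y') (hz : R z z') :
    wordPair (L.map Prod.fst) x y = wordPair (L.map Prod.snd) x' y' ∧
      wordTriple (L.map Prod.fst) x y z = wordTriple (L.map Prod.snd) x' y' z' := by
  induction L generalizing x y z x' y' z' with
  | nil => exact ⟨rfl, rfl⟩
  | cons p l ih =>
    have ih := fun {x y z x' y' z' : ℕ} (hx : R x x') (hy : R y y') (hz : R z z') =>
      ih (fun p hp => hR p (List.mem_cons_of_mem _ hp)) hx hy hz
    have hp := fun {x x'} => hR p List.mem_cons_self x x'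
    have hv : ∀ {x y x' y' : ℕ}, R x x' → R y y' →
        genPair p.1 x y = genPair p.2 x' y' := fun hx hy => by
      obtain ⟨a1, a2, -⟩ := (hp hx).1
      obtain ⟨b1, b2, -⟩ := (hp hy).1
      simp only [genPair, a1, a2, b1, b2]
    have hw : genTriple p.1 x y z = genTriple p.2 x' y' z' := by
      obtain ⟨a1, a2, a3⟩ := (hp hx).1
      obtain ⟨b1, b2, b3⟩ := (hp hy).1
      obtain ⟨c1, c2, c3⟩ := (hp hz).1
      simp only [genTriple, genAnti, a1, a2, a3, b1, b2, b3, c1, c2, c3]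
    have ihv : ∀ {x y x' y' : ℕ}, R x x' → R y y' →
        wordPair (l.map Prod.fst) (natAdjSwap p.1 x) (natAdjSwap p.1 y) =
          wordPair (l.map Prod.snd) (natAdjSwap p.2 x') (natAdjSwap p.2 y') :=
      fun hx hy => (ih (hp hx).2 (hp hy).2 (hp hy).2).1
    have ihw := (ih (hp hx).2 (hp hy).2 (hp hz).2).2
    refine ⟨?_, ?_⟩
    · rw [List.map_cons, List.map_cons, wordPair, wordPair, hv hx hy, ihv hx hy]
    · rw [List.map_cons, List.map_cons, wordTriple, wordTriple, hw, ihw]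
      simp only [triplePairing, hv hx hy, hv hy hz, hv hz hx, ihv hx hy, ihv hy hz, ihv hz hx]

/-- The letters `1` and `4` leave one model point for each of the seven possible positions: below,
the two points of each pair, between the pairs, and above. -/
theorem exists_far_position {i j : ℕ} (hij : i + 2 ≤ j) (x : ℕ) :
    ∃ p : Fin 7, SamePosition i 1 x p ∧ SamePosition j 4 x p := by
  have h : x < i ∨ x = i ∨ x = i + 1 ∨ (i + 1 < x ∧ x < j) ∨ x = j ∨ x = j + 1 ∨ j + 1 < x := by
    omega
  unfold SamePosition
  rcases h with h | h | h | h | h | h | h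
  exacts [⟨0, by simp; omega⟩, ⟨1, by simp; omega⟩, ⟨2, by simp; omega⟩, ⟨3, by simp; omega⟩,
    ⟨4, by simp; omega⟩, ⟨5, by simp; omega⟩, ⟨6, by simp; omega⟩]

theorem exists_near_position (i x : ℕ) :
    ∃ p : Fin 5, SamePosition i 1 x p ∧ SamePosition (i + 1) 2 x p := by
  have h : x < i ∨ x = i ∨ x = i + 1 ∨ x = i + 2 ∨ i + 2 < x := by omega
  unfold SamePosition
  rcases h with h | h | h | h | h
  exacts [⟨0, by simp; omega⟩, ⟨1, by simp; omega⟩, ⟨2, by simp; omega⟩, ⟨3, by simp; omega⟩,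
    ⟨4, by simp; omega⟩]

theorem word_comm_fin : ∀ x y z : Fin 7, wordPair [1, 4] x y = wordPair [4, 1] x y ∧
    wordTriple [1, 4] x y z = wordTriple [4, 1] x y z := by
  decide +kernel

theorem word_braid_fin : ∀ x y z : Fin 5, wordPair [2, 1, 2] x y = wordPair [1, 2, 1] x y ∧
    wordTriple [2, 1, 2] x y z = wordTriple [1, 2, 1] x y z := by
  decide +kernel

theorem tripleGen_commute {n : ℕ} {i j : Fin (n - 1)} (hij : i.val + 2 ≤ j.val) :
    tripleGen n i * tripleGen n j = tripleGen n j * tripleGen n i := by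
  have key : ∀ x y z : Fin n,
      ([i, j].map (tripleGen n)).prod.v x y = ([j, i].map (tripleGen n)).prod.v x y ∧
        ([i, j].map (tripleGen n)).prod.w x y z = ([j, i].map (tripleGen n)).prod.w x y z := by
    intro x y z
    have hR : ∀ p ∈ [(i.val, 1), (j.val, 4)], ∀ x x' : ℕ,
        (SamePosition i 1 x x' ∧ SamePosition j 4 x x') → SamePosition p.1 p.2 x x' ∧
        (SamePosition i 1 (natAdjSwap p.1 x) (natAdjSwap p.2 x') ∧
          SamePosition j 4 (natAdjSwap p.1 x) (natAdjSwap p.2 x')) := by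
      intro p hp x x' h
      simp only [List.mem_cons, List.not_mem_nil, or_false] at hp
      unfold SamePosition natAdjSwap at *
      rcases hp with rfl | rfl <;> refine ⟨by simp only; omega, ?_⟩ <;> simp only <;>
        split_ifs <;> omega
    obtain ⟨x', hx⟩ := exists_far_position hij x
    obtain ⟨y', hy⟩ := exists_far_position hij y
    obtain ⟨z', hz⟩ := exists_far_position hij z
    have h1 := word_congr _ [(i.val, 1), (j.val, 4)] hR hx hy hz
    have h2 := word_congr _ [(j.val, 4), (i.val, 1)]
      (fun p hp => hR p (by simpa [or_comm] using hp)) hx hy hz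
    have h3 := word_comm_fin x' y' z'
    rw [(list_prod_tripleGen _ x y z).1, (list_prod_tripleGen _ x y z).2,
      (list_prod_tripleGen _ x y z).1, (list_prod_tripleGen _ x y z).2]
    exact ⟨h1.1.trans (h3.1.trans h2.1.symm), h1.2.trans (h3.2.trans h2.2.symm)⟩
  simp only [List.map_cons, List.map_nil, List.prod_cons, List.prod_nil, mul_one] at key
  ext x y z
  · exact (key x y x).1
  · exact (key x y z).2
  · have := adjSwap_rels n _ (Or.inl ⟨i, j, hij, rfl⟩)
    simp only [map_mul, map_inv, FreeGroup.lift_apply_of, mul_inv_eq_one] at this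
    simp only [mul_s, tripleGen, this]

theorem tripleGen_braid {n : ℕ} {i j : Fin (n - 1)} (hij : i.val + 1 = j.val) :
    tripleGen n j * tripleGen n i * tripleGen n j =
      tripleGen n i * tripleGen n j * tripleGen n i := by
  have key : ∀ x y z : Fin n,
      ([j, i, j].map (tripleGen n)).prod.v x y = ([i, j, i].map (tripleGen n)).prod.v x y ∧
        ([j, i, j].map (tripleGen n)).prod.w x y z =
          ([i, j, i].map (tripleGen n)).prod.w x y z := by
    intro x y z
    have hR : ∀ p ∈ [(i.val, 1), (j.val, 2)], ∀ x x' : ℕ,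
        (SamePosition i 1 x x' ∧ SamePosition j 2 x x') → SamePosition p.1 p.2 x x' ∧
        (SamePosition i 1 (natAdjSwap p.1 x) (natAdjSwap p.2 x') ∧
          SamePosition j 2 (natAdjSwap p.1 x) (natAdjSwap p.2 x')) := by
      intro p hp x x' h
      simp only [List.mem_cons, List.not_mem_nil, or_false] at hp
      unfold SamePosition natAdjSwap at *
      rcases hp with rfl | rfl <;> refine ⟨by simp only; omega, ?_⟩ <;> simp only <;>
        split_ifs <;> omega
    obtain ⟨x', hx⟩ := exists_near_position i x
    obtain ⟨y', hy⟩ := exists_near_position i y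
    obtain ⟨z', hz⟩ := exists_near_position i z
    rw [hij] at hx hy hz
    have h1 := word_congr _ [(j.val, 2), (i.val, 1), (j.val, 2)]
      (fun p hp => hR p (by simp at hp ⊢; tauto)) hx hy hz
    have h2 := word_congr _ [(i.val, 1), (j.val, 2), (i.val, 1)]
      (fun p hp => hR p (by simp at hp ⊢; tauto)) hx hy hz
    have h3 := word_braid_fin x' y' z'
    rw [(list_prod_tripleGen _ x y z).1, (list_prod_tripleGen _ x y z).2,
      (list_prod_tripleGen _ x y z).1, (list_prod_tripleGen _ x y z).2]
    exact ⟨h1.1.trans (h3.1.trans h2.1.symm), h1.2.trans (h3.2.trans h2.2.symm)⟩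
  simp only [List.map_cons, List.map_nil, List.prod_cons, List.prod_nil, mul_one,
    ← mul_assoc] at key
  ext x y z
  · exact (key x y x).1
  · exact (key x y z).2
  · have := adjSwap_rels n _ (Or.inr ⟨i, j, hij, rfl⟩)
    simp only [map_mul, map_inv, FreeGroup.lift_apply_of, mul_inv_eq_one] at this
    simp only [mul_s, tripleGen, this]

theorem tripleGen_rels (n : ℕ) : ∀ r ∈ braidRels n, FreeGroup.lift (tripleGen n) r = 1 := by
  rintro r (⟨i, j, hij, rfl⟩ | ⟨i, j, hij, rfl⟩)
  · simp only [map_mul, map_inv, FreeGroup.lift_apply_of, mul_inv_eq_one]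
    exact tripleGen_commute hij
  · simp only [map_mul, map_inv, FreeGroup.lift_apply_of, mul_inv_eq_one]
    exact tripleGen_braid hij

/-- The homomorphism from the braid group to the group of functions on pairs and triples. -/
def braidTriple (n : ℕ) : BraidGroup n →* TripleGroup (Fin n) :=
  PresentedGroup.toGroup (tripleGen_rels n)

theorem braidTriple_of (n : ℕ) (i : Fin (n - 1)) :
    braidTriple n (PresentedGroup.of i) = tripleGen n i := PresentedGroup.toGroup.of _

theorem braidPerm_of (n : ℕ) (i : Fin (n - 1)) :
    braidPerm n (PresentedGroup.of i) = adjSwap n i := PresentedGroup.toGroup.of _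

theorem perm_comp_braidTriple (n : ℕ) : perm.comp (braidTriple n) = braidPerm n := by
  refine PresentedGroup.ext fun i => ?_
  rw [MonoidHom.comp_apply, braidTriple_of, braidPerm_of]
  rfl

theorem braidTriple_s {n : ℕ} (b : BraidGroup n) : (braidTriple n b).s = braidPerm n b :=
  DFunLike.congr_fun (perm_comp_braidTriple n) b

theorem braidTriple_mem {n : ℕ} (S : Subgroup (TripleGroup (Fin n)))
    (h : ∀ i, tripleGen n i ∈ S) (b : BraidGroup n) : braidTriple n b ∈ S := by
  have : (⊤ : Subgroup (BraidGroup n)) ≤ S.comap (braidTriple n) := by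
    rw [← PresentedGroup.closure_range_of, Subgroup.closure_le]
    rintro _ ⟨i, rfl⟩
    rw [SetLike.mem_coe, Subgroup.mem_comap, braidTriple_of]
    exact h i
  exact this (Subgroup.mem_top b)

theorem genAnti_swap (a x y : ℕ) : genAnti a y x = -genAnti a x y := by
  unfold genAnti
  split_ifs <;> omega

theorem braidTriple_mem_alternatingSubgroup {n : ℕ} (b : BraidGroup n) :
    braidTriple n b ∈ alternatingSubgroup (Fin n) := by
  refine braidTriple_mem (alternatingSubgroup _) (fun a => ?_) b
  refine ⟨fun i j => ?_, fun i => ?_, fun i j k => ?_, fun i j k => ?_⟩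
  · simp only [tripleGen, genPair]; grind
  · simp only [tripleGen, genPair]; grind
  · simp only [tripleGen, genTriple]
    rw [genAnti_swap a i k, genAnti_swap a j i, genAnti_swap a k j]
    split_ifs <;> ring
  · simp only [tripleGen, genTriple]
    rw [genAnti_swap a i k, genAnti_swap a j i, genAnti_swap a k j]
    split_ifs <;> ring

theorem natAdjSwap_cases (a x : ℕ) : (x = a ∧ natAdjSwap a x = a + 1) ∨
    (x = a + 1 ∧ natAdjSwap a x = a) ∨ (x < a ∧ natAdjSwap a x = x) ∨
    (a + 1 < x ∧ natAdjSwap a x = x) := by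
  unfold natAdjSwap
  split_ifs <;> omega

/-- The transposition reverses the order of the pair `{a, a + 1}` and of no other pair. -/
theorem genPair_inversion (a x y : ℕ) (h : x ≠ y) :
    (genPair a x y : ZMod 2) =
      (if x < y then 1 else 0) - (if natAdjSwap a x < natAdjSwap a y then 1 else 0) := by
  have h2 : (-1 : ZMod 2) = 1 := rfl
  rcases natAdjSwap_cases a x with ⟨hx, hx'⟩ | ⟨hx, hx'⟩ | ⟨hx, hx'⟩ | ⟨hx, hx'⟩ <;>
  rcases natAdjSwap_cases a y with ⟨hy, hy'⟩ | ⟨hy, hy'⟩ | ⟨hy, hy'⟩ | ⟨hy, hy'⟩ <;>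
  rw [hx', hy', genPair] <;> split_ifs <;> first | omega | simp [h2]

/-- Modulo `3`, `maxSign` is the position of the maximum, counted from `1`. The transposition moves
the maximum exactly when `a` and `a + 1` are both present and the third index is smaller, which is
the support of `genTriple`; and `-2 = 1` modulo `3`. -/
theorem genTriple_inversion (a x y z : ℕ) (h1 : x ≠ y) (h2 : y ≠ z) (h3 : x ≠ z) :
    (genTriple a x y z : ZMod 3) =
      maxSign x y z - maxSign (natAdjSwap a x) (natAdjSwap a y) (natAdjSwap a z) := by
  have key : ∀ x y : ℕ, x ≠ y →
    (x = a ∧ y = a + 1 ∧ genAnti a x y = 1 ∧ ¬ natAdjSwap a x < natAdjSwap a y ∧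
      natAdjSwap a y < natAdjSwap a x) ∨
    (x = a + 1 ∧ y = a ∧ genAnti a x y = -1 ∧ natAdjSwap a x < natAdjSwap a y ∧
      ¬ natAdjSwap a y < natAdjSwap a x) ∨
    (genAnti a x y = 0 ∧ (natAdjSwap a x < natAdjSwap a y ↔ x < y) ∧
      (natAdjSwap a y < natAdjSwap a x ↔ y < x)) := by
    intro x y h
    unfold natAdjSwap genAnti
    split_ifs <;> omega
  have c3 : (1 + 1 : ZMod 3) = -1 := rfl
  have c4 : (-1 - 1 : ZMod 3) = 1 := rfl
  have c5 : (2 : ZMod 3) = -1 := rfl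
  unfold genTriple maxSign
  rcases key x y h1 with ⟨_, _, e1, l1, m1⟩ | ⟨_, _, e1, l1, m1⟩ | ⟨e1, l1, m1⟩ <;>
  rcases key y z h2 with ⟨_, _, e2, l2, m2⟩ | ⟨_, _, e2, l2, m2⟩ | ⟨e2, l2, m2⟩ <;>
  rcases key z x h3.symm with ⟨_, _, e3, l3, m3⟩ | ⟨_, _, e3, l3, m3⟩ | ⟨e3, l3, m3⟩ <;>
  first
  | omega
  | simp only [e1, e2, e3, l1, l3, m1, m2, true_and, and_true, false_and, and_false,
      if_false]
    split_ifs <;> first | omega | simp [c3, c4, c5]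

theorem braidTriple_mem_inversionSubgroup {n : ℕ} (b : BraidGroup n) :
    braidTriple n b ∈ inversionSubgroup (Fin n) := by
  refine braidTriple_mem (inversionSubgroup _) (fun a => ?_) b
  have hs : (tripleGen n a).s⁻¹ = adjSwap n a := adjSwap_inv n a
  have val : ∀ x : Fin n, (adjSwap n a x).val = natAdjSwap a x := adjSwap_val n a
  refine ⟨fun i j hij => ?_, fun i j k hij hjk hik => ?_⟩
  · simp only [hs, Fin.lt_def, val]
    exact genPair_inversion a i j (Fin.val_ne_of_ne hij)
  · have := genTriple_inversion a i j k (Fin.val_ne_of_ne hij) (Fin.val_ne_of_ne hjk)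
      (Fin.val_ne_of_ne hik)
    simp only [hs]
    simp only [maxSign, ← val, ← Fin.lt_def] at this ⊢
    exact this

/-! ### Coset normal forms for the Coxeter presentation of the symmetric group. -/

section Peel

variable {G : Type} [Group G] {s : ℕ → G} {N : ℕ}

/-- The descending product `s (k - 1) * ⋯ * s a`. -/
def descProd (s : ℕ → G) (a : ℕ) : ℕ → G
  | 0 => 1
  | k + 1 => if a ≤ k then s k * descProd s a k else 1

theorem descProd_self (s : ℕ → G) (a : ℕ) : descProd s a a = 1 := by
  cases a <;> simp [descProd]

theorem descProd_succ (s : ℕ → G) {a k : ℕ} (h : a ≤ k) :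
    descProd s a (k + 1) = s k * descProd s a k := by
  simp [descProd, h]

/-- The subgroup generated by `s i` for `a ≤ i < N`. -/
def genSegment (s : ℕ → G) (a N : ℕ) : Subgroup G :=
  Subgroup.closure {g | ∃ i, a ≤ i ∧ i < N ∧ s i = g}

theorem mem_genSegment (s : ℕ → G) {a i N : ℕ} (h : a ≤ i) (h' : i < N) : s i ∈ genSegment s a N :=
  Subgroup.subset_closure ⟨i, h, h', rfl⟩

theorem descProd_commute (comm : ∀ i j, i + 2 ≤ j → j < N → s i * s j = s j * s i)
    {a j : ℕ} (hj : j < N) {k : ℕ} (hk : k < j) (ha : a ≤ k) :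
    s j * descProd s a k = descProd s a k * s j := by
  induction k, ha using Nat.le_induction with
  | base => simp [descProd_self]
  | succ k h ih =>
    rw [descProd_succ s h, ← mul_assoc, ← comm k j hk hj, mul_assoc, ih (by omega), mul_assoc]

theorem mul_descProd_of_lt (comm : ∀ i j, i + 2 ≤ j → j < N → s i * s j = s j * s i)
    (braid : ∀ i, i + 1 < N → s (i + 1) * s i * s (i + 1) = s i * s (i + 1) * s i)
    {a j : ℕ} (ha : a ≤ j) {k : ℕ} (hk : j + 2 ≤ k) (hN : k ≤ N) :
    s j * descProd s a k = descProd s a k * s (j + 1) := by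
  induction k, hk using Nat.le_induction with
  | base =>
    rw [descProd_succ s (by omega), descProd_succ s ha]
    calc s j * (s (j + 1) * (s j * descProd s a j))
        = (s j * s (j + 1) * s j) * descProd s a j := by group
      _ = s (j + 1) * s j * (s (j + 1) * descProd s a j) := by
          rw [← braid j (by omega)]; group
      _ = _ := by rw [descProd_commute comm (by omega) (Nat.lt_succ_self j) ha]; group
  | succ k h ih =>
    rw [descProd_succ s (by omega), ← mul_assoc, comm j k h (by omega), mul_assoc,
      ih (by omega), mul_assoc]

/-- Coset representatives in a group generated by involutions with the braid relations. -/
theorem exists_eq_descProd_mul (comm : ∀ i j, i + 2 ≤ j → j < N → s i * s j = s j * s i)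
    (braid : ∀ i, i + 1 < N → s (i + 1) * s i * s (i + 1) = s i * s (i + 1) * s i)
    (sq : ∀ i < N, s i * s i = 1) {a : ℕ} (ha : a ≤ N) {g : G} (hg : g ∈ genSegment s a N) :
    ∃ k, a ≤ k ∧ k ≤ N ∧ ∃ h ∈ genSegment s (a + 1) N, g = descProd s a k * h := by
  -- Left multiplication by `s j` preserves the normal form: it passes through the product if `k <
  -- j`, lengthens it if `k = j`, cancels its leading factor if `k = j + 1`, and otherwise passes
  -- through with its index raised by one.
  have step : ∀ j, a ≤ j → j < N → ∀ g : G,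
      (∃ k, a ≤ k ∧ k ≤ N ∧ ∃ h ∈ genSegment s (a + 1) N, g = descProd s a k * h) →
      ∃ k, a ≤ k ∧ k ≤ N ∧ ∃ h ∈ genSegment s (a + 1) N, s j * g = descProd s a k * h := by
    rintro j haj hjN _ ⟨k, hak, hkN, h, hh, rfl⟩
    rcases lt_trichotomy k j with hkj | rfl | hjk
    · refine ⟨k, hak, hkN, s j * h, mul_mem (mem_genSegment s (by omega) hjN) hh, ?_⟩
      rw [← mul_assoc, descProd_commute comm hjN hkj hak, mul_assoc]
    · exact ⟨k + 1, by omega, hjN, h, hh, by rw [descProd_succ s hak, mul_assoc]⟩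
    · obtain rfl | hlt : k = j + 1 ∨ j + 2 ≤ k := by omega
      · refine ⟨j, haj, by omega, h, hh, ?_⟩
        rw [descProd_succ s haj, ← mul_assoc, ← mul_assoc, sq j hjN, one_mul]
      · refine ⟨k, hak, hkN, s (j + 1) * h, mul_mem (mem_genSegment s (by omega) (by omega)) hh, ?_⟩
        rw [← mul_assoc, mul_descProd_of_lt comm braid haj hlt hkN, mul_assoc]
  induction hg using Subgroup.closure_induction_left with
  | one => exact ⟨a, le_rfl, ha, 1, one_mem _, by rw [descProd_self, one_mul]⟩
  | mul_left x hx y hy ih =>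
    obtain ⟨j, h1, h2, rfl⟩ := hx
    exact step j h1 h2 y ih
  | inv_mul_cancel x hx y hy ih =>
    obtain ⟨j, h1, h2, rfl⟩ := hx
    rw [inv_eq_of_mul_eq_one_left (sq j h2)]
    exact step j h1 h2 y ih

theorem genSegment_apply_eq_self (π : G →* Equiv.Perm ℕ)
    (hπ : ∀ i < N, π (s i) = Equiv.swap i (i + 1)) {a x : ℕ} (hx : x < a) {g : G}
    (hg : g ∈ genSegment s a N) : π g x = x := by
  have : genSegment s a N ≤ (MulAction.stabilizer (Equiv.Perm ℕ) x).comap π := by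
    rw [genSegment, Subgroup.closure_le]
    rintro _ ⟨i, h1, h2, rfl⟩
    rw [SetLike.mem_coe, Subgroup.mem_comap, MulAction.mem_stabilizer_iff, hπ i h2]
    exact Equiv.swap_apply_of_ne_of_ne (by omega) (by omega)
  exact this hg

theorem descProd_apply (π : G →* Equiv.Perm ℕ)
    (hπ : ∀ i < N, π (s i) = Equiv.swap i (i + 1)) {a k : ℕ} (h : a ≤ k) (hk : k ≤ N) :
    π (descProd s a k) a = k := by
  induction k, h using Nat.le_induction with
  | base => simp [descProd_self]
  | succ k h ih =>
    rw [descProd_succ s h, map_mul, Equiv.Perm.mul_apply, ih (by omega), hπ k (by omega),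
      Equiv.swap_apply_left]

/-- An element whose permutation fixes the first `k` points is a product of the generators that
do not move these points. -/
theorem mem_genSegment_of_fix (comm : ∀ i j, i + 2 ≤ j → j < N → s i * s j = s j * s i)
    (braid : ∀ i, i + 1 < N → s (i + 1) * s i * s (i + 1) = s i * s (i + 1) * s i)
    (sq : ∀ i < N, s i * s i = 1) (π : G →* Equiv.Perm ℕ)
    (hπ : ∀ i < N, π (s i) = Equiv.swap i (i + 1)) {g : G} (hg : g ∈ genSegment s 0 N)
    {k : ℕ} (hk : k ≤ N) (hfix : ∀ x < k, π g x = x) : g ∈ genSegment s k N := by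
  induction k with
  | zero => exact hg
  | succ k ih =>
    obtain ⟨l, hkl, hl, h, hh, rfl⟩ := exists_eq_descProd_mul comm braid sq (by omega : k ≤ N)
      (ih (by omega) fun x hx => hfix x (by omega))
    -- The normal form sends `k` to `l`, so fixing `k` makes the descending product empty.
    have := hfix k (Nat.lt_succ_self k)
    rw [map_mul, Equiv.Perm.mul_apply, genSegment_apply_eq_self π hπ (Nat.lt_succ_self k) hh,
      descProd_apply π hπ hkl hl] at this
    rw [this, descProd_self, one_mul]
    exact hh

end Peel

/-! ### The pure braid group as the normal closure of the squares. -/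

/-- The braid generator with index `i`, extended by `1`. -/
def braidGen (n i : ℕ) : BraidGroup n :=
  if h : i < n - 1 then PresentedGroup.of ⟨i, h⟩ else 1

theorem braidGen_eq {n i : ℕ} (h : i < n - 1) : braidGen n i = PresentedGroup.of ⟨i, h⟩ :=
  dif_pos h

theorem braidGen_comm {n i j : ℕ} (hij : i + 2 ≤ j) (hj : j < n - 1) :
    braidGen n i * braidGen n j = braidGen n j * braidGen n i := by
  rw [braidGen_eq hj, braidGen_eq (by omega : i < n - 1), ← mul_inv_eq_one]
  exact PresentedGroup.one_of_mem (Or.inl ⟨⟨i, by omega⟩, ⟨j, hj⟩, hij, rfl⟩)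

theorem braidGen_braid {n i : ℕ} (hi : i + 1 < n - 1) :
    braidGen n (i + 1) * braidGen n i * braidGen n (i + 1) =
      braidGen n i * braidGen n (i + 1) * braidGen n i := by
  rw [braidGen_eq hi, braidGen_eq (by omega : i < n - 1), ← mul_inv_eq_one]
  exact PresentedGroup.one_of_mem (Or.inr ⟨⟨i, by omega⟩, ⟨i + 1, hi⟩, rfl, rfl⟩)

theorem genSegment_braidGen (n : ℕ) : genSegment (braidGen n) 0 (n - 1) = ⊤ := by
  rw [eq_top_iff, ← PresentedGroup.closure_range_of, Subgroup.closure_le]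
  rintro _ ⟨i, rfl⟩
  have := mem_genSegment (braidGen n) (Nat.zero_le i.val) i.isLt
  rwa [braidGen_eq i.isLt] at this

/-- Permutations of `Fin n` as permutations of the natural numbers. -/
def permNat (n : ℕ) : Equiv.Perm (Fin n) →* Equiv.Perm ℕ :=
  Equiv.Perm.extendDomainHom Fin.equivSubtype

theorem permNat_apply {n : ℕ} (p : Equiv.Perm (Fin n)) (x : Fin n) :
    permNat n p x = (p x).val :=
  Equiv.Perm.extendDomain_apply_image p Fin.equivSubtype x

theorem permNat_apply_of_le {n : ℕ} (p : Equiv.Perm (Fin n)) {x : ℕ} (h : n ≤ x) :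
    permNat n p x = x :=
  Equiv.Perm.extendDomain_apply_not_subtype p Fin.equivSubtype (by omega)

theorem permNat_adjSwap {n : ℕ} (i : Fin (n - 1)) :
    permNat n (adjSwap n i) = Equiv.swap i.val (i.val + 1) := by
  ext x
  by_cases hx : x < n
  · rw [permNat_apply _ ⟨x, hx⟩, adjSwap_val, Equiv.swap_apply_def]
  · rw [permNat_apply_of_le _ (not_lt.mp hx), Equiv.swap_apply_of_ne_of_ne] <;> omega

/-- The pure braid group is the normal closure of the squares of the generators, and the
stabilizers of initial segments are generated by it and the later generators. -/
theorem exists_genSegment_mul_normalClosure {n k : ℕ} (hk : k ≤ n - 1) (b : BraidGroup n)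
    (hb : ∀ x : Fin n, x.val < k → braidPerm n b x = x) :
    ∃ h ∈ genSegment (braidGen n) k (n - 1),
      ∃ p ∈ Subgroup.normalClosure (Set.range fun i : Fin (n - 1) =>
        (PresentedGroup.of i : BraidGroup n) ^ 2), b = h * p := by
  set D := Subgroup.normalClosure (Set.range fun i : Fin (n - 1) =>
        (PresentedGroup.of i : BraidGroup n) ^ 2) with hD
  have hDker : D ≤ (braidPerm n).ker := by
    refine Subgroup.normalClosure_le_normal ?_
    rintro _ ⟨i, rfl⟩
    rw [SetLike.mem_coe, MonoidHom.mem_ker, map_pow, braidPerm_of, sq]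
    exact Equiv.swap_mul_self _ _
  have map_seg : ∀ a, (genSegment (braidGen n) a (n - 1)).map (QuotientGroup.mk' D) =
      genSegment (fun i => QuotientGroup.mk' D (braidGen n i)) a (n - 1) := by
    intro a
    rw [genSegment, MonoidHom.map_closure, genSegment]
    congr 1
    ext x
    constructor
    · rintro ⟨_, ⟨i, h1, h2, rfl⟩, rfl⟩
      exact ⟨i, h1, h2, rfl⟩
    · rintro ⟨i, h1, h2, rfl⟩
      exact ⟨_, ⟨i, h1, h2, rfl⟩, rfl⟩
  let π : BraidGroup n ⧸ D →* Equiv.Perm ℕ :=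
    (permNat n).comp (QuotientGroup.lift D (braidPerm n) hDker)
  have hπ : ∀ c, π (QuotientGroup.mk' D c) = permNat n (braidPerm n c) := fun c => rfl
  -- Modulo `D` the generators become involutions, so the normal form applies in the quotient.
  have key := mem_genSegment_of_fix (s := fun i => QuotientGroup.mk' D (braidGen n i)) (N := n - 1)
    (fun i j hij hj => by rw [← map_mul, braidGen_comm hij hj, map_mul])
    (fun i hi => by simp only [← map_mul, braidGen_braid hi])
    (fun i hi => by
      rw [← map_mul, braidGen_eq hi, ← sq]
      exact (QuotientGroup.eq_one_iff _).mpr (Subgroup.subset_normalClosure ⟨_, rfl⟩))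
    π (fun i hi => by rw [hπ, braidGen_eq hi, braidPerm_of, permNat_adjSwap])
    (g := QuotientGroup.mk' D b)
    (by
      rw [← map_seg, genSegment_braidGen]
      exact ⟨b, Subgroup.mem_top b, rfl⟩)
    hk (fun x hx => by
      rw [hπ]
      have hn : x < n := by omega
      rw [permNat_apply _ ⟨x, hn⟩, hb _ hx])
  rw [← map_seg] at key
  obtain ⟨h, hh, e⟩ := key
  exact ⟨h, hh, h⁻¹ * b, QuotientGroup.eq.mp e, by group⟩

theorem ker_braidPerm (n : ℕ) : (braidPerm n).ker =
    Subgroup.normalClosure (Set.range fun i : Fin (n - 1) =>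
      (PresentedGroup.of i : BraidGroup n) ^ 2) := by
  refine le_antisymm (fun b hb => ?_) (Subgroup.normalClosure_le_normal ?_)
  · obtain ⟨h, hh, p, hp, rfl⟩ := exists_genSegment_mul_normalClosure (le_refl (n - 1)) b
      (fun x _ => by rw [MonoidHom.mem_ker.mp hb]; rfl)
    -- No generator is left beyond index `n - 2`, so the first factor is trivial.
    have : genSegment (braidGen n) (n - 1) (n - 1) = ⊥ := by
      rw [genSegment, Subgroup.closure_eq_bot_iff]
      rintro _ ⟨i, h1, h2, rfl⟩
      omega
    rw [this, Subgroup.mem_bot] at hh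
    rwa [hh, one_mul]
  · rintro _ ⟨i, rfl⟩
    rw [SetLike.mem_coe, MonoidHom.mem_ker, map_pow, braidPerm_of, sq]
    exact Equiv.swap_mul_self _ _

theorem braidPerm_surjective (n : ℕ) : Function.Surjective (braidPerm n) := by
  cases n with
  | zero => exact fun p => ⟨1, Subsingleton.elim _ _⟩
  | succ m =>
    have h := Equiv.Perm.mclosure_swap_castSucc_succ m
    have : Submonoid.closure (Set.range fun i : Fin m => Equiv.swap i.castSucc i.succ) ≤
        MonoidHom.mrange (braidPerm (m + 1)) := by
      rw [Submonoid.closure_le]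
      rintro _ ⟨i, rfl⟩
      exact ⟨PresentedGroup.of i, braidPerm_of (m + 1) i⟩
    rw [h] at this
    exact fun p => this (Submonoid.mem_top p)

/-! ### Bilinearity of commutators in class two. -/

section ClassTwo

variable {G : Type} [Group G] {P : Subgroup G}

theorem commutatorElement_mul_left_of_central
    (hP : ∀ x ∈ P, ∀ y ∈ P, ∀ z ∈ P, Commute ⁅x, y⁆ z) {x y z : G} (hx : x ∈ P) (hy : y ∈ P)
    (hz : z ∈ P) : ⁅x * y, z⁆ = ⁅x, z⁆ * ⁅y, z⁆ := by
  have h : ⁅x * y, z⁆ = x * ⁅y, z⁆ * x⁻¹ * ⁅x, z⁆ := by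
    simp only [commutatorElement_def]; group
  rw [h, ← (hP y hy z hz x hx).eq, mul_inv_cancel_right]
  exact hP y hy z hz _ (P.mul_mem (P.mul_mem (P.mul_mem hx hz) (P.inv_mem hx)) (P.inv_mem hz))

theorem commutatorElement_mul_right_of_central
    (hP : ∀ x ∈ P, ∀ y ∈ P, ∀ z ∈ P, Commute ⁅x, y⁆ z) {x y z : G} (hx : x ∈ P) (hy : y ∈ P)
    (hz : z ∈ P) : ⁅z, x * y⁆ = ⁅z, x⁆ * ⁅z, y⁆ := by
  have h : ⁅z, x * y⁆ = ⁅z, x⁆ * (x * ⁅z, y⁆ * x⁻¹) := by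
    simp only [commutatorElement_def]; group
  rw [h, ← (hP z hz y hy x hx).eq, mul_inv_cancel_right]

/-- In a class two group, the commutators of the generators generate the commutators. -/
theorem commutatorElement_mem_closure_of_central
    (hP : ∀ x ∈ P, ∀ y ∈ P, ∀ z ∈ P, Commute ⁅x, y⁆ z) {S : Set G} (hS : Subgroup.closure S = P)
    {D : Subgroup G} (hD : ∀ x ∈ S, ∀ y ∈ S, ⁅x, y⁆ ∈ D) {x y : G} (hx : x ∈ P) (hy : y ∈ P) :
    ⁅x, y⁆ ∈ D := by
  have hSP : S ⊆ P := hS ▸ Subgroup.subset_closure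
  have inv_left : ∀ x ∈ P, ∀ y ∈ P, ⁅x⁻¹, y⁆ = ⁅x, y⁆⁻¹ := fun x hx y hy => by
    rw [eq_inv_iff_mul_eq_one, ← commutatorElement_mul_left_of_central hP (P.inv_mem hx) hx hy,
      inv_mul_cancel, commutatorElement_one_left]
  have inv_right : ∀ x ∈ P, ∀ y ∈ P, ⁅y, x⁻¹⁆ = ⁅y, x⁆⁻¹ := fun x hx y hy => by
    rw [eq_inv_iff_mul_eq_one, ← commutatorElement_mul_right_of_central hP (P.inv_mem hx) hx hy,
      inv_mul_cancel, commutatorElement_one_right]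
  have step : ∀ y ∈ P, ∀ x ∈ S, ⁅x, y⁆ ∈ D := by
    intro y hy x hx
    rw [← hS] at hy
    induction hy using Subgroup.closure_induction with
    | mem y hy => exact hD x hx y hy
    | one => rw [commutatorElement_one_right]; exact D.one_mem
    | mul y z hy hz h1 h2 =>
      rw [hS] at hy hz
      rw [commutatorElement_mul_right_of_central hP hy hz (hSP hx)]
      exact D.mul_mem h1 h2
    | inv y hy h =>
      rw [hS] at hy
      rw [inv_right y hy x (hSP hx)]
      exact D.inv_mem h
  rw [← hS] at hx
  induction hx using Subgroup.closure_induction with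
  | mem x hx => exact step y hy x hx
  | one => rw [commutatorElement_one_left]; exact D.one_mem
  | mul x z hx hz h1 h2 =>
    rw [hS] at hx hz
    rw [commutatorElement_mul_left_of_central hP hx hz hy]
    exact D.mul_mem h1 h2
  | inv x hx h =>
    rw [hS] at hx
    rw [inv_left x hx y hy]
    exact D.inv_mem h

end ClassTwo

/-! ### Maps to free Abelian groups that hit multiples of a basis. -/

section Basis

/-- A homomorphism to a free Abelian group that sends generators to multiples of basis elements is
injective. -/
theorem eq_one_of_map_generators {A K : Type} [CommGroup A] [Fintype K] [DecidableEq K]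
    (a : K → A) (ha : Subgroup.closure (Set.range a) = ⊤) (f : A →* Multiplicative (K → ℤ))
    {c : ℤ} (hc : c ≠ 0) (hf : ∀ k, f (a k) = Multiplicative.ofAdd (Pi.single k c)) {x : A}
    (hx : f x = 1) : x = 1 := by
  have key : ∀ x : A, ∃ m : K → ℤ, x = ∏ k, a k ^ m k := by
    intro x
    have hx : x ∈ Subgroup.closure (Set.range a) := ha ▸ Subgroup.mem_top x
    induction hx using Subgroup.closure_induction with
    | mem x hx =>
      obtain ⟨k, rfl⟩ := hx
      refine ⟨Pi.single k 1, ?_⟩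
      rw [Finset.prod_eq_single k]
      · simp
      · intro l _ hl; simp [hl]
      · simp
    | one => exact ⟨0, by simp⟩
    | mul x y _ _ h1 h2 =>
      obtain ⟨m, rfl⟩ := h1
      obtain ⟨m', rfl⟩ := h2
      exact ⟨m + m', by simp [zpow_add, Finset.prod_mul_distrib]⟩
    | inv x _ h =>
      obtain ⟨m, rfl⟩ := h
      exact ⟨-m, by simp⟩
  obtain ⟨m, rfl⟩ := key x
  have h0 : ∑ k, m k • (Pi.single k c : K → ℤ) = 0 := by
    have : (f (∏ k, a k ^ m k)).toAdd = ∑ k, m k • (Pi.single k c : K → ℤ) := by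
      simp [map_prod, hf, toAdd_prod]
    rw [← this, hx]; rfl
  refine Finset.prod_eq_one fun k _ => ?_
  have := congrFun h0 k
  rw [Finset.sum_apply, Finset.sum_eq_single k] at this
  · simp only [Pi.smul_apply, Pi.single_eq_same, smul_eq_mul, Pi.zero_apply, mul_eq_zero, hc,
      or_false] at this
    rw [this, zpow_zero]
  · intro l _ hl; simp [Pi.single_eq_of_ne hl.symm]
  · simp

theorem exists_map_eq_of_single {A K : Type} [Group A] [Fintype K] [DecidableEq K]
    (a : K → A) (f : A →* Multiplicative (K → ℤ))
    {c : ℤ} (hf : ∀ k, f (a k) = Multiplicative.ofAdd (Pi.single k c)) (m : K → ℤ) :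
    ∃ x, f x = Multiplicative.ofAdd (c • m) := by
  let S : AddSubgroup (K → ℤ) := Subgroup.toAddSubgroup' f.range
  have hS : c • m ∈ S := by
    rw [← Finset.univ_sum_single (c • m)]
    refine sum_mem fun k _ => ?_
    have : Pi.single k ((c • m) k) = m k • (Pi.single k c : K → ℤ) := by
      rw [← Pi.single_smul]; simp [mul_comm]
    rw [this]
    exact f.range.zpow_mem ⟨a k, hf k⟩ (m k)
  exact hS

end Basis

/-! ### The quotient of the braid group and its pure part. -/

theorem gammaThreePure_eq (n : ℕ) : gammaThreePure n =
    ⁅⁅pureBraidGroup n, pureBraidGroup n⁆, pureBraidGroup n⁆ := by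
  rw [gammaThreePure, Subgroup.lowerCentralSeries_succ, Subgroup.lowerCentralSeries_succ,
    Subgroup.lowerCentralSeries_zero]

theorem gammaThreePure_le_pureBraidGroup (n : ℕ) : gammaThreePure n ≤ pureBraidGroup n := by
  rw [gammaThreePure_eq]
  exact Subgroup.commutator_le_right _ _

theorem gammaThreePure_le_ker_braidTriple (n : ℕ) : gammaThreePure n ≤ (braidTriple n).ker := by
  have h : (pureBraidGroup n).map (braidTriple n) ≤ (perm (ι := Fin n)).ker := by
    rw [Subgroup.map_le_iff_le_comap, MonoidHom.comap_ker, perm_comp_braidTriple]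
    exact le_rfl
  rw [← Subgroup.map_eq_bot_iff, gammaThreePure_eq, Subgroup.map_commutator,
    Subgroup.map_commutator, eq_bot_iff, ← commutator_commutator_ker_perm]
  exact Subgroup.commutator_mono (Subgroup.commutator_mono h h) h

/-- The projection of `B_n / Γ_3(P_n)` to the symmetric group. -/
def modPerm (n : ℕ) : BraidModGammaThree n →* Equiv.Perm (Fin n) :=
  QuotientGroup.lift _ (braidPerm n) (gammaThreePure_le_pureBraidGroup n)

/-- The homomorphism from `B_n / Γ_3(P_n)` to the group of functions on pairs and triples. -/
def modTriple (n : ℕ) : BraidModGammaThree n →* TripleGroup (Fin n) :=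
  QuotientGroup.lift _ (braidTriple n) (gammaThreePure_le_ker_braidTriple n)

/-- The generators of `B_n / Γ_3(P_n)`. -/
def modGen (n i : ℕ) : BraidModGammaThree n := QuotientGroup.mk' _ (braidGen n i)

/-- The image of the pure braid group in `B_n / Γ_3(P_n)`. -/
def modPure (n : ℕ) : Subgroup (BraidModGammaThree n) := (modPerm n).ker

instance (n : ℕ) : (modPure n).Normal := MonoidHom.normal_ker _

theorem mem_modPure {n : ℕ} {g : BraidModGammaThree n} : g ∈ modPure n ↔ modPerm n g = 1 :=
  MonoidHom.mem_ker

theorem modPure_eq_map (n : ℕ) : modPure n = (pureBraidGroup n).map (QuotientGroup.mk' _) := by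
  ext g
  obtain ⟨b, rfl⟩ := QuotientGroup.mk'_surjective _ g
  constructor
  · exact fun h => ⟨b, h, rfl⟩
  · rintro ⟨c, hc, e⟩
    rw [← e]
    exact hc

theorem modPure_commute {n : ℕ} {x z : BraidModGammaThree n} (hx : x ∈ ⁅modPure n, modPure n⁆)
    (hz : z ∈ modPure n) : Commute x z := by
  have h : ⁅⁅modPure n, modPure n⁆, modPure n⁆ = ⊥ := by
    rw [modPure_eq_map, ← Subgroup.map_commutator, ← Subgroup.map_commutator, ← gammaThreePure_eq,
      Subgroup.map_eq_bot_iff, QuotientGroup.ker_mk']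
  rw [Subgroup.commutator_eq_bot_iff_le_centralizer] at h
  exact (Subgroup.mem_centralizer_iff.mp (h hx) z hz).symm

theorem modPure_central {n : ℕ} : ∀ x ∈ modPure n, ∀ y ∈ modPure n, ∀ z ∈ modPure n,
    Commute ⁅x, y⁆ z :=
  fun _ hx _ hy _ hz => modPure_commute (Subgroup.commutator_mem_commutator hx hy) hz

theorem modPerm_surjective (n : ℕ) : Function.Surjective (modPerm n) :=
  fun p => (braidPerm_surjective n p).imp' _ fun b hb => (hb : modPerm n (QuotientGroup.mk' _ b) = p)

theorem modTriple_s {n : ℕ} (g : BraidModGammaThree n) : (modTriple n g).s = modPerm n g := by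
  obtain ⟨b, rfl⟩ := QuotientGroup.mk'_surjective _ g
  exact braidTriple_s b

theorem modTriple_alternating {n : ℕ} (g : BraidModGammaThree n) :
    modTriple n g ∈ alternatingSubgroup (Fin n) := by
  obtain ⟨b, rfl⟩ := QuotientGroup.mk'_surjective _ g
  exact braidTriple_mem_alternatingSubgroup b

theorem modTriple_inversion {n : ℕ} (g : BraidModGammaThree n) :
    modTriple n g ∈ inversionSubgroup (Fin n) := by
  obtain ⟨b, rfl⟩ := QuotientGroup.mk'_surjective _ g
  exact braidTriple_mem_inversionSubgroup b

theorem modGen_comm {n i j : ℕ} (hij : i + 2 ≤ j) (hj : j < n - 1) :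
    modGen n i * modGen n j = modGen n j * modGen n i := by
  rw [modGen, modGen, ← map_mul, braidGen_comm hij hj, map_mul]

theorem modGen_braid {n i : ℕ} (hi : i + 1 < n - 1) :
    modGen n (i + 1) * modGen n i * modGen n (i + 1) =
      modGen n i * modGen n (i + 1) * modGen n i := by
  simp only [modGen, ← map_mul, braidGen_braid hi]

theorem modPerm_modGen {n i : ℕ} (hi : i < n - 1) : modPerm n (modGen n i) = adjSwap n ⟨i, hi⟩ := by
  rw [modGen, braidGen_eq hi]
  exact braidPerm_of n _

theorem modTriple_modGen {n i : ℕ} (hi : i < n - 1) :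
    modTriple n (modGen n i) = tripleGen n ⟨i, hi⟩ := by
  rw [modGen, braidGen_eq hi]
  exact braidTriple_of n _

theorem modPerm_modGen_val {n i : ℕ} (hi : i < n - 1) (x : Fin n) :
    (modPerm n (modGen n i) x).val = natAdjSwap i x := by
  rw [modPerm_modGen hi]
  exact adjSwap_val n _ x

theorem modGen_sq_mem {n i : ℕ} (hi : i < n - 1) : modGen n i ^ 2 ∈ modPure n := by
  rw [mem_modPure, map_pow, modPerm_modGen hi, sq]
  exact Equiv.swap_mul_self _ _

theorem modPure_eq_closure (n : ℕ) : modPure n = Subgroup.closure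
    {x | ∃ i, i < n - 1 ∧ ∃ g : BraidModGammaThree n, x = g * modGen n i ^ 2 * g⁻¹} := by
  rw [modPure_eq_map, pureBraidGroup, ker_braidPerm,
    Subgroup.map_normalClosure _ _ (QuotientGroup.mk'_surjective _), Subgroup.normalClosure]
  congr 1
  ext x
  rw [Group.mem_conjugatesOfSet_iff]
  constructor
  · rintro ⟨_, ⟨_, ⟨i, rfl⟩, rfl⟩, h⟩
    obtain ⟨g, rfl⟩ := isConj_iff.mp h
    refine ⟨i, i.isLt, g, ?_⟩
    rw [modGen, braidGen_eq i.isLt, map_pow]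
  · rintro ⟨i, hi, g, rfl⟩
    refine ⟨_, ⟨_, ⟨⟨i, hi⟩, rfl⟩, rfl⟩, isConj_iff.mpr ⟨g, ?_⟩⟩
    rw [modGen, braidGen_eq hi, map_pow]

theorem exists_eq_genSegment_mul {n k : ℕ} (hk : k ≤ n - 1) (g : BraidModGammaThree n)
    (hg : ∀ x : Fin n, x.val < k → modPerm n g x = x) :
    ∃ h ∈ genSegment (modGen n) k (n - 1), ∃ p ∈ modPure n, g = h * p := by
  obtain ⟨b, rfl⟩ := QuotientGroup.mk'_surjective _ g
  obtain ⟨h, hh, p, hp, rfl⟩ := exists_genSegment_mul_normalClosure hk b hg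
  rw [← ker_braidPerm] at hp
  refine ⟨QuotientGroup.mk' _ h, ?_, QuotientGroup.mk' _ p, ?_, map_mul _ _ _⟩
  · have : genSegment (braidGen n) k (n - 1) ≤
        (genSegment (modGen n) k (n - 1)).comap (QuotientGroup.mk' _) := by
      rw [genSegment, Subgroup.closure_le]
      rintro _ ⟨i, h1, h2, rfl⟩
      exact mem_genSegment (modGen n) h1 h2
    exact this hh
  · rw [modPure_eq_map]
    exact ⟨p, hp, rfl⟩

theorem genSegment_commute {n k i : ℕ} (hk : i + 2 ≤ k) {h : BraidModGammaThree n}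
    (hh : h ∈ genSegment (modGen n) k (n - 1)) : Commute h (modGen n i) := by
  have : genSegment (modGen n) k (n - 1) ≤ Subgroup.centralizer {modGen n i} := by
    rw [genSegment, Subgroup.closure_le]
    rintro _ ⟨j, h1, h2, rfl⟩
    rw [SetLike.mem_coe, Subgroup.mem_centralizer_singleton_iff]
    exact (modGen_comm (by omega) h2).symm
  exact Subgroup.mem_centralizer_singleton_iff.mp (this hh)

/-! ### Generators of the pure part and of its commutator subgroup. -/

section Generators

variable {n : ℕ}

theorem commutator_conj {G : Type} [Group G] (g x y : G) :
    g * ⁅x, y⁆ * g⁻¹ = ⁅g * x * g⁻¹, g * y * g⁻¹⁆ := by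
  simp only [commutatorElement_def]; group

/-- The conjugate by `g` of the square of the first generator. -/
def pairElt (g : BraidModGammaThree n) : BraidModGammaThree n := g * modGen n 0 ^ 2 * g⁻¹

/-- The conjugate by `g` of the commutator of the squares of the first two generators. -/
def tripleElt (g : BraidModGammaThree n) : BraidModGammaThree n :=
  g * ⁅modGen n 0 ^ 2, modGen n 1 ^ 2⁆ * g⁻¹

theorem pairElt_mul (g h : BraidModGammaThree n) : pairElt (g * h) = g * pairElt h * g⁻¹ := by
  simp only [pairElt]; group

theorem tripleElt_mul (g h : BraidModGammaThree n) :
    tripleElt (g * h) = g * tripleElt h * g⁻¹ := by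
  simp only [tripleElt]; group

theorem pairElt_mem (hn : 3 ≤ n) (g : BraidModGammaThree n) : pairElt g ∈ modPure n :=
  Subgroup.Normal.conj_mem inferInstance _ (modGen_sq_mem (by omega)) g

theorem tripleElt_mem (hn : 3 ≤ n) (g : BraidModGammaThree n) :
    tripleElt g ∈ ⁅modPure n, modPure n⁆ :=
  Subgroup.Normal.conj_mem inferInstance _ (Subgroup.commutator_mem_commutator
    (modGen_sq_mem (by omega)) (modGen_sq_mem (by omega))) g

theorem commutator_le_modPure (n : ℕ) : ⁅modPure n, modPure n⁆ ≤ modPure n :=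
  Subgroup.commutator_le_right _ _

theorem pairElt_mul_gen_zero (g : BraidModGammaThree n) :
    pairElt (g * modGen n 0) = pairElt g := by
  simp only [pairElt]; group

/-- Since `g⁻¹ * h` fixes the first two points, it is `u * p` with `u` a word in generators
commuting with the first one and `p` pure. Conjugation by `u` does nothing to the first square, and
conjugation by `p` changes it by a commutator. -/
theorem pairElt_congr (hn : 3 ≤ n) {g h : BraidModGammaThree n}
    (hgh : ∀ x : Fin n, x.val < 2 → modPerm n g x = modPerm n h x) :
    ∃ c ∈ ⁅modPure n, modPure n⁆, pairElt h = c * pairElt g := by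
  obtain ⟨u, hu, p, hp, e⟩ := exists_eq_genSegment_mul (k := 2) (by omega) (g⁻¹ * h) (by
    intro x hx
    rw [map_mul, map_inv, Equiv.Perm.mul_apply, ← hgh x hx]
    exact Equiv.symm_apply_apply _ _)
  have hu0 : u * modGen n 0 ^ 2 * u⁻¹ = modGen n 0 ^ 2 := by
    rw [((genSegment_commute le_rfl hu).pow_right 2).eq, mul_inv_cancel_right]
  refine ⟨g * u * ⁅p, modGen n 0 ^ 2⁆ * (g * u)⁻¹, Subgroup.Normal.conj_mem inferInstance _
    (Subgroup.commutator_mem_commutator hp (modGen_sq_mem (by omega))) _, ?_⟩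
  have hh : h = g * (u * p) := by rw [← e]; group
  calc pairElt h = g * u * ⁅p, modGen n 0 ^ 2⁆ * (g * u)⁻¹ *
        (g * (u * modGen n 0 ^ 2 * u⁻¹) * g⁻¹) := by
        rw [hh]; simp only [pairElt, commutatorElement_def]; group
    _ = _ := by rw [hu0]; rfl

/-- Same decomposition as for pairs, but the pure factor now acts trivially because commutators are
central in the pure part. -/
theorem tripleElt_congr (hn : 3 ≤ n) {g h : BraidModGammaThree n}
    (hgh : ∀ x : Fin n, x.val < 3 → modPerm n g x = modPerm n h x) :
    tripleElt h = tripleElt g := by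
  have hker : ∀ p ∈ modPure n, tripleElt p = tripleElt 1 := by
    intro p hp
    have h1 := tripleElt_mem hn (1 : BraidModGammaThree n)
    have h2 : tripleElt p = p * tripleElt 1 * p⁻¹ := by rw [← tripleElt_mul, mul_one]
    rw [h2, ← (modPure_commute h1 hp).eq, mul_inv_cancel_right]
  have hfix : ∀ x : Fin n, x.val < 3 → modPerm n (g⁻¹ * h) x = x := by
    intro x hx
    rw [map_mul, map_inv, Equiv.Perm.mul_apply, ← hgh x hx]
    exact Equiv.symm_apply_apply _ _
  suffices hs : tripleElt (g⁻¹ * h) = tripleElt 1 by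
    have : tripleElt h = g * tripleElt (g⁻¹ * h) * g⁻¹ := by
      rw [← tripleElt_mul, mul_inv_cancel_left]
    rw [this, hs, ← tripleElt_mul, mul_one]
  -- The decomposition with `k = 3` needs `3 ≤ n - 1`; for `n = 3`, fixing three points already
  -- means being pure.
  obtain rfl | hn' : n = 3 ∨ 4 ≤ n := by omega
  · exact hker _ (mem_modPure.mpr (Equiv.ext fun x => hfix x x.isLt))
  · obtain ⟨u, hu, p, hp, e⟩ := exists_eq_genSegment_mul (k := 3) (by omega) (g⁻¹ * h) hfix
    rw [e, tripleElt_mul, hker p hp]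
    have h0 := (genSegment_commute (i := 0) (by omega) hu).pow_right 2
    have h1 := (genSegment_commute (i := 1) (by omega) hu).pow_right 2
    rw [← tripleElt_mul, mul_one, tripleElt, commutator_conj, h0.eq, h1.eq]
    simp [tripleElt]

theorem conj_mem_modPure (g x : BraidModGammaThree n) (hx : x ∈ modPure n) :
    g * x * g⁻¹ ∈ modPure n :=
  Subgroup.Normal.conj_mem inferInstance _ hx g

/-- Conjugation by the half twist `s * t * s` exchanges `s` and `t`, so the full twist commutes with
both. -/
theorem commute_sq_of_braid {G : Type} [Group G] {s t : G} (hb : t * s * t = s * t * s) :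
    Commute s ((s * t * s) ^ 2) ∧ Commute t ((s * t * s) ^ 2) := by
  have h0 : s * (s * t * s) = (s * t * s) * t :=
    calc s * (s * t * s) = s * (t * s * t) := by rw [hb]
      _ = _ := by group
  have h1 : t * (s * t * s) = (s * t * s) * s :=
    calc t * (s * t * s) = (t * s * t) * s := by group
      _ = _ := by rw [hb]
  generalize s * t * s = d at h0 h1
  constructor
  · rw [Commute, SemiconjBy, sq, ← mul_assoc, h0, mul_assoc, h1, mul_assoc]
  · rw [Commute, SemiconjBy, sq, ← mul_assoc, h1, mul_assoc, h0, mul_assoc]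

theorem braid_sq_eq {G : Type} [Group G] {s t : G} (hb : t * s * t = s * t * s) :
    (s * t * s) ^ 2 = (s * t ^ 2 * s⁻¹) * (s ^ 2 * t ^ 2) ∧
      (s * t * s) ^ 2 = s ^ 2 * (t * s ^ 2 * t⁻¹) * t ^ 2 := by
  simp only [sq]
  constructor
  · calc s * t * s * (s * t * s) = s * t * s * (t * s * t) := by rw [hb]
      _ = s * t * (s * t * s) * t := by simp only [mul_assoc]
      _ = s * t * (t * s * t) * t := by rw [hb]
      _ = _ := by group
  · calc s * t * s * (s * t * s) = s * t * s * (t * s * t) := by rw [hb]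
      _ = s * (t * s * t) * (s * t) := by simp only [mul_assoc]
      _ = s * (s * t * s) * (s * t) := by rw [hb]
      _ = _ := by group

/-- The full twist factors as `(s * t ^ 2 * s⁻¹) * (s ^ 2 * t ^ 2)` and commutes with `s ^ 2`.
Expanding that trivial commutator bilinearly leaves `tripleElt s * tripleElt 1 = 1`. -/
theorem tripleElt_mul_gen_zero (hn : 3 ≤ n) (g : BraidModGammaThree n) :
    tripleElt (g * modGen n 0) = (tripleElt g)⁻¹ := by
  have hb : modGen n 1 * modGen n 0 * modGen n 1 = modGen n 0 * modGen n 1 * modGen n 0 :=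
    modGen_braid (i := 0) (by omega)
  suffices h : tripleElt (modGen n 0) = (tripleElt (1 : BraidModGammaThree n))⁻¹ by
    rw [tripleElt_mul, h, ← mul_one g, tripleElt_mul g 1]; group
  set s := modGen n 0
  set t := modGen n 1
  have hs : s ^ 2 ∈ modPure n := modGen_sq_mem (by omega)
  have ht : t ^ 2 ∈ modPure n := modGen_sq_mem (by omega)
  have hD := (braid_sq_eq hb).1
  have h1 : ⁅s ^ 2, (s * t * s) ^ 2⁆ = 1 :=
    commutatorElement_eq_one_iff_commute.mpr ((commute_sq_of_braid hb).1.pow_left 2)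
  rw [hD, commutatorElement_mul_right_of_central modPure_central (conj_mem_modPure _ _ ht)
    (mul_mem hs ht) hs, commutatorElement_mul_right_of_central modPure_central hs ht hs,
    commutatorElement_self, one_mul] at h1
  rw [eq_inv_iff_mul_eq_one]
  have e : tripleElt s = ⁅s ^ 2, s * t ^ 2 * s⁻¹⁆ := by
    rw [tripleElt, commutator_conj]
    congr 1
    change s * s ^ 2 * s⁻¹ = s ^ 2
    group
  rwa [e, tripleElt, one_mul, inv_one, mul_one]

/-- The other factorization of the full twist, commuted with `t ^ 2`, gives the sign for the second
generator. -/
theorem tripleElt_mul_gen_one (hn : 3 ≤ n) (g : BraidModGammaThree n) :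
    tripleElt (g * modGen n 1) = (tripleElt g)⁻¹ := by
  have hb : modGen n 1 * modGen n 0 * modGen n 1 = modGen n 0 * modGen n 1 * modGen n 0 :=
    modGen_braid (i := 0) (by omega)
  suffices h : tripleElt (modGen n 1) = (tripleElt (1 : BraidModGammaThree n))⁻¹ by
    rw [tripleElt_mul, h, ← mul_one g, tripleElt_mul g 1]; group
  set s := modGen n 0
  set t := modGen n 1
  have hs : s ^ 2 ∈ modPure n := modGen_sq_mem (by omega)
  have ht : t ^ 2 ∈ modPure n := modGen_sq_mem (by omega)
  have hD := (braid_sq_eq hb).2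
  have h1 : ⁅(s * t * s) ^ 2, t ^ 2⁆ = 1 :=
    commutatorElement_eq_one_iff_commute.mpr ((commute_sq_of_braid hb).2.pow_left 2).symm
  rw [hD, commutatorElement_mul_left_of_central modPure_central
    (mul_mem hs (conj_mem_modPure _ _ hs)) ht ht,
    commutatorElement_mul_left_of_central modPure_central hs (conj_mem_modPure _ _ hs) ht,
    commutatorElement_self, mul_one] at h1
  rw [eq_comm, inv_eq_iff_mul_eq_one]
  have e : tripleElt t = ⁅t * s ^ 2 * t⁻¹, t ^ 2⁆ := by
    rw [tripleElt, commutator_conj]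
    congr 1
    change t * t ^ 2 * t⁻¹ = t ^ 2
    group
  rwa [e, tripleElt, one_mul, inv_one, mul_one]

/-- The generator with index `i + 1` is conjugate to the one with index `i`. -/
theorem modGen_succ_conj {i : ℕ} (hi : i + 1 < n - 1) :
    modGen n (i + 1) ^ 2 =
      (modGen n i * modGen n (i + 1)) * modGen n i ^ 2 * (modGen n i * modGen n (i + 1))⁻¹ := by
  have hb := modGen_braid hi
  have h : modGen n (i + 1) =
      (modGen n i * modGen n (i + 1)) * modGen n i * (modGen n i * modGen n (i + 1))⁻¹ := by
    rw [← hb]; group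
  conv_lhs => rw [h]
  rw [conj_pow]

theorem exists_modGen_sq_eq_pairElt {i : ℕ} (hi : i < n - 1) :
    ∃ g : BraidModGammaThree n, modGen n i ^ 2 = pairElt g := by
  induction i with
  | zero => exact ⟨1, by simp [pairElt]⟩
  | succ i ih =>
    obtain ⟨g, hg⟩ := ih (by omega)
    exact ⟨_ * g, by rw [modGen_succ_conj hi, hg, ← pairElt_mul]⟩

theorem modPure_eq_closure_pairElt (hn : 3 ≤ n) :
    Subgroup.closure (Set.range (pairElt (n := n))) = modPure n := by
  refine le_antisymm ?_ ?_
  · rw [Subgroup.closure_le]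
    rintro _ ⟨g, rfl⟩
    exact pairElt_mem hn g
  · rw [modPure_eq_closure]
    refine Subgroup.closure_mono ?_
    rintro _ ⟨i, hi, g, rfl⟩
    obtain ⟨h, hh⟩ := exists_modGen_sq_eq_pairElt hi
    exact ⟨g * h, by rw [hh, pairElt_mul]⟩

theorem exists_modPerm_eq {k : ℕ} (hk : k ≤ n) (y : Fin k → Fin n) (hy : Function.Injective y) :
    ∃ g, ∀ i : Fin k, modPerm n g (Fin.castLE hk i) = y i := by
  obtain ⟨p, hp⟩ := (Equiv.Perm.isMultiplyPretransitive (Fin n) k).exists_smul_eq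
    (Fin.castLEEmb hk) ⟨y, hy⟩
  obtain ⟨g, rfl⟩ := modPerm_surjective n p
  exact ⟨g, fun i => DFunLike.congr_fun hp i⟩

end Generators

/-! ### Commutators of two pairs: disjoint, meeting in a point, or equal. -/

section Commutators

variable {n : ℕ}

theorem exists_modPerm_eq_two (hn : 3 ≤ n) {a b : Fin n} (hab : a ≠ b) :
    ∃ g, modPerm n g ⟨0, by omega⟩ = a ∧ modPerm n g ⟨1, by omega⟩ = b := by
  obtain ⟨g, hg⟩ := exists_modPerm_eq (by omega : 2 ≤ n) ![a, b]
    (by intro i j h; fin_cases i <;> fin_cases j <;> simp_all)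
  exact ⟨g, hg 0, hg 1⟩

theorem exists_modPerm_eq_three (hn : 3 ≤ n) {a b c : Fin n} (hab : a ≠ b) (hac : a ≠ c)
    (hbc : b ≠ c) : ∃ g, modPerm n g ⟨0, by omega⟩ = a ∧ modPerm n g ⟨1, by omega⟩ = b ∧
      modPerm n g ⟨2, by omega⟩ = c := by
  obtain ⟨g, hg⟩ := exists_modPerm_eq hn ![a, b, c]
    (by intro i j h; fin_cases i <;> fin_cases j <;> simp_all)
  exact ⟨g, hg 0, hg 1, hg 2⟩

theorem exists_modPerm_eq_four (hn : 4 ≤ n) {a b c d : Fin n} (hab : a ≠ b) (hac : a ≠ c)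
    (had : a ≠ d) (hbc : b ≠ c) (hbd : b ≠ d) (hcd : c ≠ d) :
    ∃ g, modPerm n g ⟨0, by omega⟩ = a ∧ modPerm n g ⟨1, by omega⟩ = b ∧
      modPerm n g ⟨2, by omega⟩ = c ∧ modPerm n g ⟨3, by omega⟩ = d := by
  obtain ⟨g, hg⟩ := exists_modPerm_eq hn ![a, b, c, d]
    (by intro i j h; fin_cases i <;> fin_cases j <;> simp_all)
  exact ⟨g, hg 0, hg 1, hg 2, hg 3⟩

theorem forall_lt_two (hn : 3 ≤ n) {p q : Equiv.Perm (Fin n)}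
    (h0 : p ⟨0, by omega⟩ = q ⟨0, by omega⟩) (h1 : p ⟨1, by omega⟩ = q ⟨1, by omega⟩) :
    ∀ x : Fin n, x.val < 2 → p x = q x := by
  rintro ⟨x, hx⟩ h
  obtain rfl | rfl : x = 0 ∨ x = 1 := by simp only at h; omega
  exacts [h0, h1]

theorem forall_lt_three (hn : 3 ≤ n) {p q : Equiv.Perm (Fin n)}
    (h0 : p ⟨0, by omega⟩ = q ⟨0, by omega⟩) (h1 : p ⟨1, by omega⟩ = q ⟨1, by omega⟩)
    (h2 : p ⟨2, by omega⟩ = q ⟨2, by omega⟩) :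
    ∀ x : Fin n, x.val < 3 → p x = q x := by
  rintro ⟨x, hx⟩ h
  obtain rfl | rfl | rfl : x = 0 ∨ x = 1 ∨ x = 2 := by simp only at h; omega
  exacts [h0, h1, h2]

theorem modPerm_modGen_mk (i x y : ℕ) (h : natAdjSwap i x = y) (hi : i < n - 1) (hx : x < n)
    (hy : y < n) : modPerm n (modGen n i) ⟨x, hx⟩ = ⟨y, hy⟩ :=
  Fin.ext ((modPerm_modGen_val hi _).trans h)

theorem commutator_pairElt_congr (hn : 3 ≤ n) {x g h : BraidModGammaThree n} (hx : x ∈ modPure n)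
    (hgh : ∀ x : Fin n, x.val < 2 → modPerm n g x = modPerm n h x) :
    ⁅x, pairElt h⁆ = ⁅x, pairElt g⁆ := by
  obtain ⟨c, hc, e⟩ := pairElt_congr hn hgh
  rw [e, commutatorElement_mul_right_of_central modPure_central (commutator_le_modPure n hc)
    (pairElt_mem hn g) hx, commutatorElement_eq_one_iff_commute.mpr (modPure_commute hc hx).symm,
    one_mul]

theorem tripleElt_conj_mem_closure (g : BraidModGammaThree n) {x : BraidModGammaThree n}
    (hx : x ∈ Subgroup.closure (Set.range (tripleElt (n := n)))) :
    g * x * g⁻¹ ∈ Subgroup.closure (Set.range (tripleElt (n := n))) := by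
  induction hx using Subgroup.closure_induction with
  | mem x hx =>
    obtain ⟨h, rfl⟩ := hx
    exact Subgroup.subset_closure ⟨g * h, tripleElt_mul g h⟩
  | one => simp
  | mul x y _ _ h1 h2 =>
    have : g * (x * y) * g⁻¹ = (g * x * g⁻¹) * (g * y * g⁻¹) := by group
    rw [this]
    exact mul_mem h1 h2
  | inv x _ h =>
    have : g * x⁻¹ * g⁻¹ = (g * x * g⁻¹)⁻¹ := by group
    rw [this]
    exact inv_mem h

theorem commute_modGen_zero_of_fix (hn : 3 ≤ n) {g : BraidModGammaThree n}
    (hg : ∀ x : Fin n, x.val < 2 → modPerm n g x = x) :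
    ∃ h, Commute h (modGen n 0) ∧ modPerm n h = modPerm n g := by
  obtain ⟨h, hh, p, hp, rfl⟩ := exists_eq_genSegment_mul (k := 2) (by omega) g hg
  exact ⟨h, genSegment_commute le_rfl hh, by rw [map_mul, mem_modPure.mp hp, mul_one]⟩

/-- The case of pairs that meet in the point `1`. -/
theorem commutator_pairElt_mem_of_one (hn : 3 ≤ n) {g : BraidModGammaThree n}
    (h0 : modPerm n g ⟨0, by omega⟩ = ⟨1, by omega⟩)
    (h1 : 2 ≤ (modPerm n g ⟨1, by omega⟩).val) :
    ⁅modGen n 0 ^ 2, pairElt g⁆ ∈ Subgroup.closure (Set.range (tripleElt (n := n))) := by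
  obtain ⟨f, f0, f1, f2⟩ := exists_modPerm_eq_three hn (a := ⟨0, by omega⟩) (b := ⟨1, by omega⟩)
    (c := modPerm n g ⟨1, by omega⟩) (by simp [Fin.ext_iff])
    (by rw [ne_eq, Fin.ext_iff]; simp only; omega) (by rw [ne_eq, Fin.ext_iff]; simp only; omega)
  obtain ⟨h, hh, hf⟩ := commute_modGen_zero_of_fix hn (g := f)
    (forall_lt_two hn (q := 1) f0 f1)
  rw [← hf] at f0 f1 f2
  -- The product of the first two generators conjugates the first into the second, so this choice of
  -- lift replaces `pairElt g` by the conjugate under `h` of the second square, while `h` fixes the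
  -- first square.
  have hd : ⁅modGen n 0 ^ 2, pairElt g⁆ =
      ⁅modGen n 0 ^ 2, pairElt (h * (modGen n 0 * modGen n 1))⁆ := by
    refine commutator_pairElt_congr hn (modGen_sq_mem (by omega)) (forall_lt_two hn ?_ ?_)
    · simp only [map_mul, Equiv.Perm.mul_apply]
      rw [modPerm_modGen_mk 1 0 0 rfl (by omega) _ (by omega),
        modPerm_modGen_mk 0 0 1 rfl (by omega) _ (by omega), h0, f1]
    · simp only [map_mul, Equiv.Perm.mul_apply]
      rw [modPerm_modGen_mk 1 1 2 rfl (by omega) _ (by omega),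
        modPerm_modGen_mk 0 2 2 rfl (by omega) _ (by omega)]
      exact f2
  have e1 : pairElt (modGen n 0 * modGen n 1) = modGen n 1 ^ 2 :=
    (modGen_succ_conj (i := 0) (by omega)).symm
  have e2 : modGen n 0 ^ 2 = h * modGen n 0 ^ 2 * h⁻¹ := by
    rw [(hh.pow_right 2).eq, mul_inv_cancel_right]
  rw [hd, pairElt_mul, e1]
  conv in ⁅_, _⁆ => rw [e2]
  rw [← commutator_conj]
  exact Subgroup.subset_closure ⟨h, rfl⟩

/-- Conjugation by the first generator fixes its square and exchanges the points `0` and `1`, which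
reduces this to the pairs through `1`. -/
theorem commutator_pairElt_mem_of_zero (hn : 3 ≤ n) {g : BraidModGammaThree n}
    (h0 : modPerm n g ⟨0, by omega⟩ = ⟨0, by omega⟩)
    (h1 : 2 ≤ (modPerm n g ⟨1, by omega⟩).val) :
    ⁅modGen n 0 ^ 2, pairElt g⁆ ∈ Subgroup.closure (Set.range (tripleElt (n := n))) := by
  have key := commutator_pairElt_mem_of_one hn (g := modGen n 0 * g)
    (by
      rw [map_mul, Equiv.Perm.mul_apply, h0,
        modPerm_modGen_mk 0 0 1 rfl (by omega) _ (by omega)])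
    (by
      rw [map_mul, Equiv.Perm.mul_apply, modPerm_modGen_val (by omega), natAdjSwap]
      split_ifs <;> omega)
  have := tripleElt_conj_mem_closure (modGen n 0)⁻¹ key
  rw [commutator_conj, pairElt_mul] at this
  convert this using 2 <;> group

/-- The case of disjoint pairs. -/
theorem commutator_pairElt_eq_one (hn : 3 ≤ n) {g : BraidModGammaThree n}
    (h0 : 2 ≤ (modPerm n g ⟨0, by omega⟩).val)
    (h1 : 2 ≤ (modPerm n g ⟨1, by omega⟩).val) :
    ⁅modGen n 0 ^ 2, pairElt g⁆ = 1 := by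
  have hne : modPerm n g ⟨0, by omega⟩ ≠ modPerm n g ⟨1, by omega⟩ := by
    rw [ne_eq, (modPerm n g).injective.eq_iff]; simp
  have hn4 : 4 ≤ n := by
    have := Fin.val_ne_of_ne hne
    have := (modPerm n g ⟨0, by omega⟩).isLt
    have := (modPerm n g ⟨1, by omega⟩).isLt
    omega
  obtain ⟨f, f0, f1, f2, f3⟩ := exists_modPerm_eq_four hn4 (a := ⟨0, by omega⟩)
    (b := ⟨1, by omega⟩) (c := modPerm n g ⟨0, by omega⟩) (d := modPerm n g ⟨1, by omega⟩)
    (by simp [Fin.ext_iff])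
    (by rw [ne_eq, Fin.ext_iff]; simp only; omega) (by rw [ne_eq, Fin.ext_iff]; simp only; omega)
    (by rw [ne_eq, Fin.ext_iff]; simp only; omega) (by rw [ne_eq, Fin.ext_iff]; simp only; omega)
    hne
  obtain ⟨h, hh, hf⟩ := commute_modGen_zero_of_fix hn (g := f)
    (forall_lt_two hn (q := 1) f0 f1)
  rw [← hf] at f2 f3
  -- The word after `h` conjugates generator `0` into generator `2`, which commutes with generator
  -- `0`.
  have hd : ⁅modGen n 0 ^ 2, pairElt g⁆ =
      ⁅modGen n 0 ^ 2, pairElt (h * (modGen n 1 * modGen n 2 * (modGen n 0 * modGen n 1)))⁆ := by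
    refine commutator_pairElt_congr hn (modGen_sq_mem (by omega)) (forall_lt_two hn ?_ ?_)
    · simp only [map_mul, Equiv.Perm.mul_apply]
      rw [modPerm_modGen_mk 1 0 0 rfl (by omega) _ (by omega),
        modPerm_modGen_mk 0 0 1 rfl (by omega) _ (by omega),
        modPerm_modGen_mk 2 1 1 rfl (by omega) _ (by omega),
        modPerm_modGen_mk 1 1 2 rfl (by omega) _ (by omega)]
      exact f2
    · simp only [map_mul, Equiv.Perm.mul_apply]
      rw [modPerm_modGen_mk 1 1 2 rfl (by omega) _ (by omega),
        modPerm_modGen_mk 0 2 2 rfl (by omega) _ (by omega),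
        modPerm_modGen_mk 2 2 3 rfl (by omega) _ (by omega),
        modPerm_modGen_mk 1 3 3 rfl (by omega) _ (by omega)]
      exact f3
  have e1 : pairElt (modGen n 0 * modGen n 1) = modGen n 1 ^ 2 :=
    (modGen_succ_conj (i := 0) (by omega)).symm
  have e3 : pairElt (modGen n 1 * modGen n 2 * (modGen n 0 * modGen n 1)) = modGen n 2 ^ 2 := by
    rw [pairElt_mul, e1]
    exact (modGen_succ_conj (i := 1) (by omega)).symm
  have e2 : modGen n 0 ^ 2 = h * modGen n 0 ^ 2 * h⁻¹ := by
    rw [(hh.pow_right 2).eq, mul_inv_cancel_right]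
  rw [hd, pairElt_mul, e3]
  conv in ⁅_, _⁆ => rw [e2]
  have hc : Commute (modGen n 0) (modGen n 2) := modGen_comm (by omega) (by omega)
  rw [← commutator_conj, commutatorElement_eq_one_iff_commute.mpr (hc.pow_pow 2 2)]
  group

theorem commutator_pairElt_mem (hn : 3 ≤ n) (g : BraidModGammaThree n) :
    ⁅modGen n 0 ^ 2, pairElt g⁆ ∈ Subgroup.closure (Set.range (tripleElt (n := n))) := by
  have hne : ∀ g, (modPerm n g ⟨0, by omega⟩).val ≠ (modPerm n g ⟨1, by omega⟩).val := by
    intro g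
    rw [Fin.val_ne_iff, ne_eq, (modPerm n g).injective.eq_iff]; simp
  have ordered : ∀ g, (modPerm n g ⟨0, by omega⟩).val < (modPerm n g ⟨1, by omega⟩).val →
      ⁅modGen n 0 ^ 2, pairElt g⁆ ∈ Subgroup.closure (Set.range (tripleElt (n := n))) := by
    intro g hlt
    by_cases h0 : 2 ≤ (modPerm n g ⟨0, by omega⟩).val
    · rw [commutator_pairElt_eq_one hn h0 (by omega)]
      exact one_mem _
    by_cases h1 : 2 ≤ (modPerm n g ⟨1, by omega⟩).val
    · obtain h | h : (modPerm n g ⟨0, by omega⟩).val = 0 ∨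
        (modPerm n g ⟨0, by omega⟩).val = 1 := by omega
      · exact commutator_pairElt_mem_of_zero hn (Fin.ext h) h1
      · exact commutator_pairElt_mem_of_one hn (Fin.ext h) h1
    · have : ⁅modGen n 0 ^ 2, pairElt g⁆ = ⁅modGen n 0 ^ 2, pairElt 1⁆ := by
        refine commutator_pairElt_congr hn (modGen_sq_mem (by omega))
          (forall_lt_two hn ?_ ?_) <;> rw [map_one, Equiv.Perm.one_apply, Fin.ext_iff] <;>
          simp only <;> omega
      rw [this, pairElt, one_mul, inv_one, mul_one, commutatorElement_self]
      exact one_mem _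
  rcases lt_or_gt_of_ne (hne g) with h | h
  · exact ordered g h
  · rw [← pairElt_mul_gen_zero]
    refine ordered _ ?_
    rw [map_mul, Equiv.Perm.mul_apply, Equiv.Perm.mul_apply,
      modPerm_modGen_mk 0 0 1 rfl (by omega) _ (by omega),
      modPerm_modGen_mk 0 1 0 rfl (by omega) _ (by omega)]
    exact h

theorem commutator_eq_closure_tripleElt (hn : 3 ≤ n) :
    Subgroup.closure (Set.range (tripleElt (n := n))) = ⁅modPure n, modPure n⁆ := by
  refine le_antisymm ?_ ?_
  · rw [Subgroup.closure_le]
    rintro _ ⟨g, rfl⟩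
    exact tripleElt_mem hn g
  · rw [Subgroup.commutator_le]
    intro x hx y hy
    refine commutatorElement_mem_closure_of_central modPure_central
      (modPure_eq_closure_pairElt hn) ?_ hx hy
    rintro _ ⟨g, rfl⟩ _ ⟨h, rfl⟩
    have := tripleElt_conj_mem_closure g (commutator_pairElt_mem hn (g⁻¹ * h))
    rwa [commutator_conj, ← pairElt_mul, mul_inv_cancel_left] at this

end Commutators

/-! ### Faithfulness of the model and the values it takes. -/

section Injectivity

variable {n : ℕ}

theorem modTriple_modGen_sq {i : ℕ} (hi : i < n - 1) (x y : Fin n) :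
    (modTriple n (modGen n i ^ 2)).v x y = 2 * genPair i x y := by
  have hs : (tripleGen n ⟨i, hi⟩).s⁻¹ = adjSwap n ⟨i, hi⟩ := adjSwap_inv n _
  have val : ∀ x : Fin n, (adjSwap n ⟨i, hi⟩ x).val = natAdjSwap i x := adjSwap_val n _
  rw [map_pow, sq, mul_v, modTriple_modGen hi, hs]
  simp only [tripleGen, val, genPair, natAdjSwap]
  split_ifs <;> omega

theorem modTriple_s_of_mem {g : BraidModGammaThree n} (hg : g ∈ modPure n) :
    (modTriple n g).s = 1 := by
  rw [modTriple_s, mem_modPure.mp hg]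

theorem modTriple_mul_v {g h : BraidModGammaThree n} (hg : g ∈ modPure n) (i j : Fin n) :
    (modTriple n (g * h)).v i j = (modTriple n g).v i j + (modTriple n h).v i j := by
  rw [map_mul, mul_v, modTriple_s_of_mem hg]; rfl

theorem modTriple_v_of_mem {g : BraidModGammaThree n} (hg : g ∈ ⁅modPure n, modPure n⁆)
    (i j : Fin n) : (modTriple n g).v i j = 0 := by
  rw [Subgroup.commutator_def] at hg
  induction hg using Subgroup.closure_induction with
  | mem x hx =>
    obtain ⟨a, ha, b, hb, rfl⟩ := hx
    rw [map_commutatorElement, commutator_v _ _ (modTriple_s_of_mem ha) (modTriple_s_of_mem hb)]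
  | one => rw [map_one]; rfl
  | mul x y hx hy h1 h2 =>
    rw [← Subgroup.commutator_def] at hx
    rw [modTriple_mul_v (commutator_le_modPure n hx), h1, h2, add_zero]
  | inv x hx h =>
    rw [← Subgroup.commutator_def] at hx
    rw [map_inv, inv_v, modTriple_s_of_mem (commutator_le_modPure n hx)]
    simpa using h

theorem modTriple_mul_w {g h : BraidModGammaThree n} (hg : g ∈ ⁅modPure n, modPure n⁆)
    (i j k : Fin n) :
    (modTriple n (g * h)).w i j k = (modTriple n g).w i j k + (modTriple n h).w i j k := by
  rw [map_mul, mul_w, modTriple_s_of_mem (commutator_le_modPure n hg)]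
  simp only [triplePairing, modTriple_v_of_mem hg]
  simp

theorem modTriple_pairElt (hn : 3 ≤ n) (g : BraidModGammaThree n) (i j : Fin n) :
    (modTriple n (pairElt g)).v i j =
      2 * genPair 0 ((modPerm n g)⁻¹ i).val ((modPerm n g)⁻¹ j).val := by
  have hs := modTriple_s_of_mem (modGen_sq_mem (n := n) (i := 0) (by omega))
  rw [pairElt, map_mul, map_mul, map_inv, conj_v _ _ hs, modTriple_s,
    modTriple_modGen_sq (by omega)]

/-- The constant is `6 * 2 * 2`: the commutator contributes `6`, and each squared generator has pair
value `2`. -/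
theorem modTriple_tripleElt (hn : 3 ≤ n) (g : BraidModGammaThree n) (i j k : Fin n) :
    (modTriple n (tripleElt g)).w i j k =
      24 * triplePairing (genPair 0) (genPair 1) ((modPerm n g)⁻¹ i).val
        ((modPerm n g)⁻¹ j).val ((modPerm n g)⁻¹ k).val := by
  have h0 := modGen_sq_mem (n := n) (i := 0) (by omega)
  have h1 := modGen_sq_mem (n := n) (i := 1) (by omega)
  have hc := Subgroup.commutator_mem_commutator h0 h1
  rw [tripleElt, map_mul, map_mul, map_inv,
    conj_w _ _ (modTriple_s_of_mem (commutator_le_modPure n hc)) (modTriple_v_of_mem hc),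
    modTriple_s, map_commutatorElement,
    commutator_w _ _ (modTriple_s_of_mem h0) (modTriple_s_of_mem h1)]
  simp only [triplePairing, modTriple_modGen_sq (show 0 < n - 1 by omega),
    modTriple_modGen_sq (show 1 < n - 1 by omega)]
  ring

/-- Increasing pairs of indices. -/
abbrev IncPair (n : ℕ) : Type := {p : Fin n × Fin n // p.1 < p.2}

/-- Increasing triples of indices. -/
abbrev IncTriple (n : ℕ) : Type := {p : Fin n × Fin n × Fin n // p.1 < p.2.1 ∧ p.2.1 < p.2.2}

/-- The values on increasing pairs, on the pure part. -/
def pairValue (n : ℕ) : modPure n →* Multiplicative (IncPair n → ℤ) where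
  toFun x := Multiplicative.ofAdd fun k => (modTriple n x.1).v k.1.1 k.1.2
  map_one' := by
    refine congrArg Multiplicative.ofAdd (funext fun k => ?_)
    rw [OneMemClass.coe_one, map_one]
    rfl
  map_mul' x y := by
    rw [← ofAdd_add]
    exact congrArg Multiplicative.ofAdd (funext fun k => modTriple_mul_v x.2 _ _)

/-- The values on increasing triples, on the commutators of the pure part. -/
def tripleValue (n : ℕ) :
    (⁅modPure n, modPure n⁆ : Subgroup (BraidModGammaThree n)) →*
      Multiplicative (IncTriple n → ℤ) where
  toFun x := Multiplicative.ofAdd fun k => (modTriple n x.1).w k.1.1 k.1.2.1 k.1.2.2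
  map_one' := by
    refine congrArg Multiplicative.ofAdd (funext fun k => ?_)
    rw [OneMemClass.coe_one, map_one]
    rfl
  map_mul' x y := by
    rw [← ofAdd_add]
    exact congrArg Multiplicative.ofAdd (funext fun k => modTriple_mul_w x.2 _ _ _)

theorem exists_pair_lift (hn : 3 ≤ n) : ∃ a : IncPair n → BraidModGammaThree n,
    ∀ k, modPerm n (a k) ⟨0, by omega⟩ = k.1.1 ∧ modPerm n (a k) ⟨1, by omega⟩ = k.1.2 :=
  ⟨fun k => (exists_modPerm_eq_two hn k.2.ne).choose,
    fun k => (exists_modPerm_eq_two hn k.2.ne).choose_spec⟩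

theorem exists_triple_lift (hn : 3 ≤ n) : ∃ a : IncTriple n → BraidModGammaThree n,
    ∀ k, modPerm n (a k) ⟨0, by omega⟩ = k.1.1 ∧ modPerm n (a k) ⟨1, by omega⟩ = k.1.2.1 ∧
      modPerm n (a k) ⟨2, by omega⟩ = k.1.2.2 :=
  ⟨fun k => (exists_modPerm_eq_three hn k.2.1.ne (k.2.1.trans k.2.2).ne k.2.2.ne).choose,
    fun k => (exists_modPerm_eq_three hn k.2.1.ne (k.2.1.trans k.2.2).ne k.2.2.ne).choose_spec⟩

theorem inv_apply_val_eq (p : Equiv.Perm (Fin n)) (i : Fin n) {m : ℕ} (hm : m < n) :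
    (p⁻¹ i).val = m ↔ i = p ⟨m, hm⟩ := by
  rw [← Equiv.Perm.inv_eq_iff_eq, Fin.ext_iff]

theorem pairValue_pairElt (hn : 3 ≤ n) (k : IncPair n) {g : BraidModGammaThree n}
    (h0 : modPerm n g ⟨0, by omega⟩ = k.1.1) (h1 : modPerm n g ⟨1, by omega⟩ = k.1.2) :
    pairValue n ⟨pairElt g, pairElt_mem hn g⟩ = Multiplicative.ofAdd (Pi.single k 2) := by
  refine congrArg Multiplicative.ofAdd (funext fun l => ?_)
  have e0 := fun i => inv_apply_val_eq (modPerm n g) i (show 0 < n by omega)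
  have e1 := fun i => inv_apply_val_eq (modPerm n g) i (show 1 < n by omega)
  simp only [modTriple_pairElt hn, genPair, zero_add, e0, e1, h0, h1]
  by_cases hkl : l = k
  · subst hkl
    simp
  · rw [Pi.single_eq_of_ne hkl, if_neg, mul_zero]
    rintro (⟨e1, e2⟩ | ⟨e1, e2⟩)
    · exact hkl (Subtype.ext (Prod.ext e1 e2))
    · have := l.2
      rw [e1, e2] at this
      exact absurd k.2 this.not_gt

theorem triplePairing_genPair_ne_zero {x y z : ℕ}
    (h : triplePairing (genPair 0) (genPair 1) x y z ≠ 0) : x < 3 ∧ y < 3 ∧ z < 3 := by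
  by_contra hc
  apply h
  have : 3 ≤ x ∨ 3 ≤ y ∨ 3 ≤ z := by omega
  have key : ∀ u v, 3 ≤ u → genPair 0 u v = 0 ∧ genPair 1 u v = 0 ∧ genPair 0 v u = 0 ∧
      genPair 1 v u = 0 := by
    intro u v hu
    unfold genPair
    refine ⟨?_, ?_, ?_, ?_⟩ <;> rw [if_neg] <;> omega
  have key0 : ∀ u, genPair 0 2 u = 0 ∧ genPair 0 u 2 = 0 := by
    intro u
    unfold genPair
    refine ⟨?_, ?_⟩ <;> rw [if_neg] <;> omega
  have key1 : ∀ u, genPair 1 0 u = 0 ∧ genPair 1 u 0 = 0 := by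
    intro u
    unfold genPair
    refine ⟨?_, ?_⟩ <;> rw [if_neg] <;> omega
  unfold triplePairing
  rcases this with h | h | h
  · simp [key x y h, key x z h]
  · simp [key y x h, key y z h]
  · simp [key z x h, key z y h]

theorem tripleValue_tripleElt (hn : 3 ≤ n) (k : IncTriple n) {g : BraidModGammaThree n}
    (h0 : modPerm n g ⟨0, by omega⟩ = k.1.1) (h1 : modPerm n g ⟨1, by omega⟩ = k.1.2.1)
    (h2 : modPerm n g ⟨2, by omega⟩ = k.1.2.2) :
    tripleValue n ⟨tripleElt g, tripleElt_mem hn g⟩ = Multiplicative.ofAdd (Pi.single k 24) := by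
  refine congrArg Multiplicative.ofAdd (funext fun l => ?_)
  simp only [modTriple_tripleElt hn]
  by_cases hkl : l = k
  · subst hkl
    have e0 := (inv_apply_val_eq (modPerm n g) l.1.1 (by omega)).mpr h0.symm
    have e1 := (inv_apply_val_eq (modPerm n g) l.1.2.1 (by omega)).mpr h1.symm
    have e2 := (inv_apply_val_eq (modPerm n g) l.1.2.2 (by omega)).mpr h2.symm
    rw [e0, e1, e2, Pi.single_eq_same]
    rfl
  · rw [Pi.single_eq_of_ne hkl]
    by_contra hne
    obtain ⟨b1, b2, b3⟩ := triplePairing_genPair_ne_zero (right_ne_zero_of_mul hne)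
    have key : ∀ i : Fin n, ((modPerm n g)⁻¹ i).val < 3 →
        i = k.1.1 ∨ i = k.1.2.1 ∨ i = k.1.2.2 := by
      intro i hi
      rw [← h0, ← h1, ← h2, ← inv_apply_val_eq, ← inv_apply_val_eq, ← inv_apply_val_eq]
      omega
    have c1 := key _ b1
    have c2 := key _ b2
    have c3 := key _ b3
    have hl := l.2
    have hk := k.2
    apply hkl
    refine Subtype.ext (Prod.ext ?_ (Prod.ext ?_ ?_)) <;>
    · simp only [Fin.ext_iff, Fin.lt_def] at *
      omega

/-- A pure element that vanishes on pairs is a product of commutators. -/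
theorem mem_commutator_of_pairValue (hn : 3 ≤ n) {x : BraidModGammaThree n} (hx : x ∈ modPure n)
    (h : pairValue n ⟨x, hx⟩ = 1) : x ∈ ⁅modPure n, modPure n⁆ := by
  have hof : ∀ y : modPure n, (Abelianization.of y = 1 ↔ y.1 ∈ ⁅modPure n, modPure n⁆) := by
    intro y
    rw [← MonoidHom.mem_ker, Abelianization.ker_of, ← Subgroup.map_subtype_commutator]
    exact ⟨fun h => ⟨y, h, rfl⟩, fun ⟨z, hz, e⟩ => Subtype.ext e ▸ hz⟩
  obtain ⟨a, ha⟩ := exists_pair_lift hn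
  have hgen : Subgroup.closure (Set.range fun k =>
      Abelianization.of (⟨pairElt (a k), pairElt_mem hn (a k)⟩ : modPure n)) = ⊤ := by
    rw [eq_top_iff]
    rintro y -
    obtain ⟨⟨y, hy⟩, rfl⟩ : ∃ z, Abelianization.of z = y := QuotientGroup.mk'_surjective _ y
    have hy' := hy
    rw [← modPure_eq_closure_pairElt hn] at hy'
    induction hy' using Subgroup.closure_induction with
    | mem z hz =>
      obtain ⟨g, rfl⟩ := hz
      have hlt : ∀ g : BraidModGammaThree n,
          modPerm n g ⟨0, by omega⟩ < modPerm n g ⟨1, by omega⟩ →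
          ∀ hg, Abelianization.of (⟨pairElt g, hg⟩ : modPure n) ∈
            Subgroup.closure (Set.range fun k =>
              Abelianization.of (⟨pairElt (a k), pairElt_mem hn (a k)⟩ : modPure n)) := by
        intro g hg hmem
        obtain ⟨c, hc, e⟩ := pairElt_congr hn (g := a ⟨(_, _), hg⟩) (h := g)
          (forall_lt_two hn (ha ⟨(_, _), hg⟩).1 (ha ⟨(_, _), hg⟩).2)
        have e' : (⟨pairElt g, hmem⟩ : modPure n) = ⟨c, commutator_le_modPure n hc⟩ *
            ⟨pairElt (a ⟨(_, _), hg⟩), pairElt_mem hn _⟩ := Subtype.ext e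
        rw [e', map_mul, (hof _).mpr hc, one_mul]
        exact Subgroup.subset_closure ⟨_, rfl⟩
      rcases lt_or_gt_of_ne (show modPerm n g ⟨0, by omega⟩ ≠ modPerm n g ⟨1, by omega⟩ by
        rw [ne_eq, (modPerm n g).injective.eq_iff]; simp) with h | h
      · exact hlt g h hy
      · have e := pairElt_mul_gen_zero g
        have := hlt (g * modGen n 0) (by
          rwa [map_mul, Equiv.Perm.mul_apply, Equiv.Perm.mul_apply,
            modPerm_modGen_mk 0 0 1 rfl (by omega) _ (by omega),
            modPerm_modGen_mk 0 1 0 rfl (by omega) _ (by omega)]) (by rwa [e])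
        simpa only [e] using this
    | one => exact one_mem _
    | mul u v hu hv h1 h2 =>
      rw [modPure_eq_closure_pairElt hn] at hu hv
      exact mul_mem (h1 hu) (h2 hv)
    | inv u hu h =>
      rw [modPure_eq_closure_pairElt hn] at hu
      exact inv_mem (h hu)
  rw [← hof ⟨x, hx⟩]
  refine eq_one_of_map_generators _ hgen (Abelianization.lift (pairValue n)) (c := 2) (by simp)
    (fun k => ?_) ?_
  · rw [Abelianization.lift_apply_of]
    exact pairValue_pairElt hn k (ha k).1 (ha k).2
  · rw [Abelianization.lift_apply_of, h]

/-- Right multiplication by the first two generators permutes the three points in every way and at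
most inverts the element, so sorting the points costs only a sign. -/
theorem tripleElt_mem_closure_increasing (hn : 3 ≤ n) {D : Subgroup (BraidModGammaThree n)}
    (hD : ∀ g : BraidModGammaThree n, modPerm n g ⟨0, by omega⟩ < modPerm n g ⟨1, by omega⟩ →
      modPerm n g ⟨1, by omega⟩ < modPerm n g ⟨2, by omega⟩ → tripleElt g ∈ D)
    (g : BraidModGammaThree n) : tripleElt g ∈ D := by
  have s0 : ∀ g, modPerm n (g * modGen n 0) ⟨0, by omega⟩ = modPerm n g ⟨1, by omega⟩ ∧
      modPerm n (g * modGen n 0) ⟨1, by omega⟩ = modPerm n g ⟨0, by omega⟩ ∧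
      modPerm n (g * modGen n 0) ⟨2, by omega⟩ = modPerm n g ⟨2, by omega⟩ := by
    intro g
    simp only [map_mul, Equiv.Perm.mul_apply]
    rw [modPerm_modGen_mk 0 0 1 rfl (by omega) _ (by omega),
      modPerm_modGen_mk 0 1 0 rfl (by omega) _ (by omega),
      modPerm_modGen_mk 0 2 2 rfl (by omega) _ (by omega)]
    exact ⟨rfl, rfl, rfl⟩
  have s1 : ∀ g, modPerm n (g * modGen n 1) ⟨0, by omega⟩ = modPerm n g ⟨0, by omega⟩ ∧
      modPerm n (g * modGen n 1) ⟨1, by omega⟩ = modPerm n g ⟨2, by omega⟩ ∧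
      modPerm n (g * modGen n 1) ⟨2, by omega⟩ = modPerm n g ⟨1, by omega⟩ := by
    intro g
    simp only [map_mul, Equiv.Perm.mul_apply]
    rw [modPerm_modGen_mk 1 0 0 rfl (by omega) _ (by omega),
      modPerm_modGen_mk 1 1 2 rfl (by omega) _ (by omega),
      modPerm_modGen_mk 1 2 1 rfl (by omega) _ (by omega)]
    exact ⟨rfl, rfl, rfl⟩
  have m0 : ∀ g, tripleElt (g * modGen n 0) ∈ D → tripleElt g ∈ D := by
    intro g hg
    rwa [tripleElt_mul_gen_zero hn, inv_mem_iff] at hg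
  have m1 : ∀ g, tripleElt (g * modGen n 1) ∈ D → tripleElt g ∈ D := by
    intro g hg
    rwa [tripleElt_mul_gen_one hn, inv_mem_iff] at hg
  have ne : ∀ g, ∀ {x y : ℕ} (hx : x < n) (hy : y < n), x ≠ y →
      modPerm n g ⟨x, hx⟩ ≠ modPerm n g ⟨y, hy⟩ := by
    intro g x y hx hy hxy
    rw [ne_eq, (modPerm n g).injective.eq_iff]; simpa using hxy
  have first : ∀ g, modPerm n g ⟨0, by omega⟩ < modPerm n g ⟨1, by omega⟩ → tripleElt g ∈ D := by
    intro g h01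
    rcases lt_or_gt_of_ne (ne g (x := 1) (y := 2) (by omega) (by omega) (by simp)) with h12 | h12
    · exact hD g h01 h12
    · refine m1 g ?_
      obtain ⟨e0, e1, e2⟩ := s1 g
      rcases lt_or_gt_of_ne (ne g (x := 0) (y := 2) (by omega) (by omega) (by simp)) with h02 | h02
      · exact hD _ (by rwa [e0, e1]) (by rwa [e1, e2])
      · refine m0 _ ?_
        obtain ⟨f0, f1, f2⟩ := s0 (g * modGen n 1)
        exact hD _ (by rwa [f0, f1, e0, e1]) (by rwa [f1, f2, e0, e2])
  rcases lt_or_gt_of_ne (ne g (x := 0) (y := 1) (by omega) (by omega) (by simp)) with h01 | h01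
  · exact first g h01
  · obtain ⟨e0, e1, e2⟩ := s0 g
    exact m0 g (first _ (by rwa [e0, e1]))

theorem eq_one_of_tripleValue (hn : 3 ≤ n) {x : BraidModGammaThree n}
    (hx : x ∈ ⁅modPure n, modPure n⁆) (h : tripleValue n ⟨x, hx⟩ = 1) : x = 1 := by
  let C : Subgroup (BraidModGammaThree n) := ⁅modPure n, modPure n⁆
  let _ : CommGroup C :=
    { (inferInstance : Group C) with
      mul_comm := fun x y => Subtype.ext (modPure_commute x.2 (commutator_le_modPure n y.2)).eq }
  obtain ⟨a, ha⟩ := exists_triple_lift hn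
  have hgen : Subgroup.closure (Set.range fun k =>
      (⟨tripleElt (a k), tripleElt_mem hn (a k)⟩ : C)) = ⊤ := by
    rw [eq_top_iff]
    have hle : C ≤ (Subgroup.closure (Set.range fun k =>
      (⟨tripleElt (a k), tripleElt_mem hn (a k)⟩ : C))).map C.subtype := by
      change ⁅modPure n, modPure n⁆ ≤ _
      rw [← commutator_eq_closure_tripleElt hn, Subgroup.closure_le]
      rintro _ ⟨g, rfl⟩
      refine tripleElt_mem_closure_increasing hn (fun g h1 h2 => ?_) g
      have := tripleElt_congr hn (g := a ⟨(_, _, _), h1, h2⟩) (h := g)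
        (forall_lt_three hn (ha ⟨(_, _, _), h1, h2⟩).1 (ha ⟨(_, _, _), h1, h2⟩).2.1
          (ha ⟨(_, _, _), h1, h2⟩).2.2)
      rw [this]
      exact ⟨_, Subgroup.subset_closure ⟨_, rfl⟩, rfl⟩
    rintro ⟨y, hy⟩ _
    obtain ⟨z, hz, e⟩ := hle hy
    exact (Subtype.ext e : z = ⟨y, hy⟩) ▸ hz
  have := eq_one_of_map_generators _ hgen (tripleValue n) (c := 24) (by simp)
    (fun k => tripleValue_tripleElt hn k (ha k).1 (ha k).2.1 (ha k).2.2) h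
  exact congrArg Subtype.val this

theorem mem_commutator_of_v (hn : 3 ≤ n) {x : BraidModGammaThree n} (hx : x ∈ modPure n)
    (h : ∀ i j, (modTriple n x).v i j = 0) : x ∈ ⁅modPure n, modPure n⁆ :=
  mem_commutator_of_pairValue hn hx
    (congrArg Multiplicative.ofAdd (funext fun k => h k.1.1 k.1.2))

/-- The homomorphism to the group of functions on pairs and triples is injective. -/
theorem modTriple_injective (hn : 3 ≤ n) : Function.Injective (modTriple n) := by
  rw [injective_iff_map_eq_one]
  intro x hx
  have hP : x ∈ modPure n := by rw [mem_modPure, ← modTriple_s, hx]; rfl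
  have hC := mem_commutator_of_v hn hP (fun i j => by rw [hx]; rfl)
  exact eq_one_of_tripleValue hn hC
    (congrArg Multiplicative.ofAdd (funext fun k => by simp only [hx]; rfl))

/-- Every symmetric even function on pairs is the value of a pure element. -/
theorem exists_modPure_v_eq (hn : 3 ≤ n) (f : Fin n → Fin n → ℤ) (hsymm : ∀ i j, f i j = f j i)
    (hdiag : ∀ i, f i i = 0) (heven : ∀ i j, 2 ∣ f i j) :
    ∃ x ∈ modPure n, ∀ i j, (modTriple n x).v i j = f i j := by
  obtain ⟨a, ha⟩ := exists_pair_lift hn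
  obtain ⟨⟨x, hx⟩, hf⟩ := exists_map_eq_of_single
    (fun k => (⟨pairElt (a k), pairElt_mem hn (a k)⟩ : modPure n)) (pairValue n) (c := 2)
    (fun k => pairValue_pairElt hn k (ha k).1 (ha k).2) (fun k => f k.1.1 k.1.2 / 2)
  have hlt : ∀ i j, i < j → (modTriple n x).v i j = f i j := fun i j hij => by
    have := congrFun (congrArg Multiplicative.toAdd hf) ⟨(i, j), hij⟩
    refine this.trans ?_
    simp only [toAdd_ofAdd, Pi.smul_apply, smul_eq_mul]
    exact Int.mul_ediv_cancel' (heven i j)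
  obtain ⟨a1, a2, -, -⟩ := modTriple_alternating x
  refine ⟨x, hx, fun i j => ?_⟩
  rcases lt_trichotomy i j with h | rfl | h
  · exact hlt i j h
  · rw [hdiag, a2]
  · rw [a1, hsymm, hlt j i h]

theorem alternating_ext {F F' : Fin n → Fin n → Fin n → ℤ} (h1 : ∀ i j k, F i j k = -F j i k)
    (h2 : ∀ i j k, F i j k = -F i k j) (h1' : ∀ i j k, F' i j k = -F' j i k)
    (h2' : ∀ i j k, F' i j k = -F' i k j) (h : ∀ i j k, i < j → j < k → F i j k = F' i j k)
    (i j k : Fin n) : F i j k = F' i j k := by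
  have first : ∀ i j k, i < j → F i j k = F' i j k := by
    intro i j k hij
    rcases lt_trichotomy j k with hjk | rfl | hjk
    · exact h i j k hij hjk
    · have := h2 i j j; have := h2' i j j; omega
    rw [h2, h2']
    rcases lt_trichotomy i k with hik | rfl | hik
    · rw [h i k j hik hjk]
    · have := h1 i i j; have := h1' i i j; omega
    · rw [h1, h1', h k i j hik hij]
  rcases lt_trichotomy i j with hij | rfl | hij
  · exact first i j k hij
  · have := h1 i i k; have := h1' i i k; omega
  · rw [h1, h1', first j i k hij]

/-- Every alternating function on triples divisible by `24` is the value of a product of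
commutators. -/
theorem exists_commutator_w_eq (hn : 3 ≤ n) (F : Fin n → Fin n → Fin n → ℤ)
    (h1 : ∀ i j k, F i j k = -F j i k) (h2 : ∀ i j k, F i j k = -F i k j)
    (hdiv : ∀ i j k, 24 ∣ F i j k) :
    ∃ x ∈ ⁅modPure n, modPure n⁆, ∀ i j k, (modTriple n x).w i j k = F i j k := by
  obtain ⟨a, ha⟩ := exists_triple_lift hn
  obtain ⟨⟨x, hx⟩, hf⟩ := exists_map_eq_of_single
    (fun k => (⟨tripleElt (a k), tripleElt_mem hn (a k)⟩ :
      (⁅modPure n, modPure n⁆ : Subgroup (BraidModGammaThree n)))) (tripleValue n) (c := 24)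
    (fun k => tripleValue_tripleElt hn k (ha k).1 (ha k).2.1 (ha k).2.2)
    (fun k => F k.1.1 k.1.2.1 k.1.2.2 / 24)
  obtain ⟨-, -, a1, a2⟩ := modTriple_alternating x
  refine ⟨x, hx, alternating_ext a1 a2 h1 h2 fun i j k hij hjk => ?_⟩
  have := congrFun (congrArg Multiplicative.toAdd hf) ⟨(i, j, k), hij, hjk⟩
  refine this.trans ?_
  simp only [toAdd_ofAdd, Pi.smul_apply, smul_eq_mul]
  exact Int.mul_ediv_cancel' (hdiv i j k)

theorem dvd_modTriple_w (hn : 3 ≤ n) {x : BraidModGammaThree n}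
    (hx : x ∈ ⁅modPure n, modPure n⁆) (i j k : Fin n) : 24 ∣ (modTriple n x).w i j k := by
  rw [← commutator_eq_closure_tripleElt hn] at hx
  induction hx using Subgroup.closure_induction with
  | mem x hx =>
    obtain ⟨g, rfl⟩ := hx
    exact ⟨_, modTriple_tripleElt hn g i j k⟩
  | one => rw [map_one]; exact dvd_zero _
  | mul x y hx hy h1 h2 =>
    rw [commutator_eq_closure_tripleElt hn] at hx
    rw [modTriple_mul_w hx]
    exact dvd_add h1 h2
  | inv x hx h =>
    rw [commutator_eq_closure_tripleElt hn] at hx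
    rw [map_inv, inv_w, modTriple_s_of_mem (commutator_le_modPure n hx), dvd_neg]
    exact h

end Injectivity

/-! ### Absence of torsion in the pure part, and of elements of order two and three. -/

section Torsion

variable {n : ℕ}

theorem modTriple_pow_v {x : BraidModGammaThree n} (hx : x ∈ modPure n) (m : ℕ) (i j : Fin n) :
    (modTriple n (x ^ m)).v i j = m * (modTriple n x).v i j := by
  induction m with
  | zero => rw [pow_zero, map_one]; simp
  | succ m ih => rw [pow_succ', modTriple_mul_v hx, ih]; push_cast; ring

theorem modTriple_pow_w {x : BraidModGammaThree n} (hx : x ∈ ⁅modPure n, modPure n⁆) (m : ℕ)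
    (i j k : Fin n) : (modTriple n (x ^ m)).w i j k = m * (modTriple n x).w i j k := by
  induction m with
  | zero => rw [pow_zero, map_one]; simp
  | succ m ih => rw [pow_succ', modTriple_mul_w hx, ih]; push_cast; ring

/-- The quotient `P_n / Γ_3(P_n)` has no torsion. -/
theorem eq_one_of_mem_modPure_of_pow (hn : 3 ≤ n) {x : BraidModGammaThree n} (hx : x ∈ modPure n)
    {m : ℕ} (hm : m ≠ 0) (h : x ^ m = 1) : x = 1 := by
  have hv : ∀ i j, (modTriple n x).v i j = 0 := fun i j => by
    have := modTriple_pow_v hx m i j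
    rw [h, map_one, one_v] at this
    simpa [hm] using this.symm
  have hC := mem_commutator_of_v hn hx hv
  apply modTriple_injective hn
  rw [map_one]
  ext i j k
  · exact hv i j
  · have := modTriple_pow_w hC m i j k
    rw [h, map_one, one_w] at this
    simpa [hm] using this.symm
  · rw [modTriple_s_of_mem hx]; rfl

/-- If the permutation exchanges `i` and `j`, then `g ^ 2 = 1` gives `v i j + v j i = 0`, so `v i j
= 0` by symmetry. But `v i j` is odd, since the order of `i` and `j` is reversed. So `g` is pure,
and the pure part has no torsion. -/
theorem eq_one_of_sq_eq_one (hn : 3 ≤ n) {g : BraidModGammaThree n} (h : g ^ 2 = 1) : g = 1 := by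
  refine eq_one_of_mem_modPure_of_pow hn (mem_modPure.mpr ?_) two_ne_zero h
  have hs : (modPerm n g)⁻¹ * (modPerm n g)⁻¹ = 1 := by
    rw [← mul_inv_rev, ← map_mul, ← sq, h, map_one, inv_one]
  rw [← inv_eq_one]
  ext i
  by_contra hi
  set j := (modPerm n g)⁻¹ i with hj
  have hji : (modPerm n g)⁻¹ j = i := DFunLike.congr_fun hs i
  have hne : i ≠ j := fun e => hi (congrArg Fin.val e.symm)
  have h0 : (modTriple n (g * g)).v i j = 0 := by rw [← sq, h, map_one]; rfl
  obtain ⟨a1, -⟩ := modTriple_alternating g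
  obtain ⟨b1, -⟩ := modTriple_inversion g
  rw [map_mul, mul_v, modTriple_s, ← hj, hji, a1 j i] at h0
  have h1 : (modTriple n g).v i j = 0 := by omega
  have h2 := b1 i j hne
  rw [h1, modTriple_s, ← hj, hji] at h2
  rcases lt_or_gt_of_ne hne with hlt | hlt
  · simp [hlt, hlt.not_gt] at h2
  · simp [hlt, hlt.not_gt] at h2

/-- A rotation of the triple shifts the position of the maximum by one modulo `3`. -/
theorem maxSign_rotate_ne {i j k : Fin n} (hij : i ≠ j) (hjk : j ≠ k) (hik : i ≠ k) :
    maxSign i j k - maxSign k i j ≠ 0 := by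
  have h : (-1 - 1 : ZMod 3) ≠ 0 := by decide
  unfold maxSign
  rcases lt_or_gt_of_ne hij with h1 | h1 <;> rcases lt_or_gt_of_ne hjk with h2 | h2 <;>
    rcases lt_or_gt_of_ne hik with h3 | h3 <;>
    simp [h1, h2, h3, h1.not_gt, h2.not_gt, h3.not_gt] <;> first | decide | omega

/-- On a 3-cycle the pair values `a`, `b`, `c` sum to zero. Alternation makes the three `w` terms
equal, so the triple equation is `3 * w` plus three times pairing terms; after `c` is eliminated,
the latter are a multiple of `9`. Hence `3` divides `w`, against `maxSign_rotate_ne`. -/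
theorem eq_one_of_cube_eq_one (hn : 3 ≤ n) {g : BraidModGammaThree n} (h : g ^ 3 = 1) : g = 1 := by
  refine eq_one_of_mem_modPure_of_pow hn (mem_modPure.mpr ?_) three_ne_zero h
  have h' : g * (g * g) = 1 := by rw [← h, pow_three]
  have hs : (modPerm n g)⁻¹ * ((modPerm n g)⁻¹ * (modPerm n g)⁻¹) = 1 := by
    rw [← mul_inv_rev, ← mul_inv_rev, ← map_mul, ← map_mul, mul_assoc, h', map_one, inv_one]
  rw [← inv_eq_one]
  ext i
  by_contra hi
  set k := (modPerm n g)⁻¹ i with hk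
  set j := (modPerm n g)⁻¹ k with hj
  have hji : (modPerm n g)⁻¹ j = i := DFunLike.congr_fun hs i
  have hik : i ≠ k := fun e => hi (congrArg Fin.val e.symm)
  have hkj : j ≠ k := fun e => by
    rw [e] at hji hj
    exact hik (hji.symm.trans hj.symm)
  have hij : i ≠ j := fun e => by
    rw [← e, ← hk] at hji
    exact hik hji.symm
  obtain ⟨-, -, a3, a4⟩ := modTriple_alternating g
  obtain ⟨-, b2⟩ := modTriple_inversion g
  have hw := b2 i j k hij hkj hik
  rw [modTriple_s, ← hk, ← hj, hji] at hw
  have h0 : (modTriple n (g * (g * g))).v i j = 0 := by rw [h', map_one]; rfl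
  have h1 : (modTriple n (g * (g * g))).w i j k = 0 := by rw [h', map_one]; rfl
  simp only [map_mul, mul_v, mul_w, modTriple_s, ← hk, ← hj, hji, triplePairing] at h0 h1
  rw [a3 k i j, a4 i k j, a4 j k i, a3 j i k] at h1
  set a := (modTriple n g).v i j
  set b := (modTriple n g).v j k
  set c := (modTriple n g).v k i
  set w := (modTriple n g).w i j k
  have hc : c = -a - b := by linarith
  have hw3 : w = 3 * (-(a ^ 2 + a * b + b ^ 2)) := by
    rw [hc] at h1
    linarith
  have : (w : ZMod 3) = 0 := by
    rw [ZMod.intCast_zmod_eq_zero_iff_dvd]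
    exact ⟨_, hw3⟩
  rw [this] at hw
  exact maxSign_rotate_ne hij hkj hik hw.symm

end Torsion

/-! ### Lifting rotations to elements of the same order. -/

section Rotation

variable {n : ℕ}

theorem modTriple_mul_pow_v {x y : BraidModGammaThree n} (hx : x ∈ modPure n) (m : ℕ)
    (i j : Fin n) : (modTriple n ((x * y) ^ m)).v i j =
      ∑ k ∈ Finset.range m, (modTriple n x).v (((modPerm n y)⁻¹ ^ k) i)
        (((modPerm n y)⁻¹ ^ k) j) + (modTriple n (y ^ m)).v i j := by
  induction m generalizing i j with
  | zero => simp
  | succ m ih =>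
    rw [pow_succ', mul_assoc, modTriple_mul_v hx, map_mul, mul_v, ih, modTriple_s,
      Finset.sum_range_succ', pow_succ', map_mul, mul_v, modTriple_s]
    simp only [pow_succ, Equiv.Perm.mul_apply, pow_zero, Equiv.Perm.one_apply]
    ring

/-- A product of commutators has zero pair values, so it adds no pairing terms and its triple values
simply sum along the orbit. -/
theorem modTriple_mul_pow_w {x y : BraidModGammaThree n} (hx : x ∈ ⁅modPure n, modPure n⁆) (m : ℕ)
    (i j k : Fin n) : (modTriple n ((x * y) ^ m)).w i j k =
      ∑ l ∈ Finset.range m, (modTriple n x).w (((modPerm n y)⁻¹ ^ l) i)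
        (((modPerm n y)⁻¹ ^ l) j) (((modPerm n y)⁻¹ ^ l) k) + (modTriple n (y ^ m)).w i j k := by
  have hv : ∀ i j, (modTriple n ((x * y) ^ m)).v i j = (modTriple n (y ^ m)).v i j := by
    intro i j
    rw [modTriple_mul_pow_v (commutator_le_modPure n hx)]
    simp [modTriple_v_of_mem hx]
  induction m generalizing i j k with
  | zero => simp
  | succ m ih =>
    have hv' : ∀ i j, (modTriple n ((x * y) ^ m)).v i j = (modTriple n (y ^ m)).v i j := by
      intro i j
      rw [modTriple_mul_pow_v (commutator_le_modPure n hx)]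
      simp [modTriple_v_of_mem hx]
    rw [pow_succ', mul_assoc, modTriple_mul_w hx, map_mul, mul_w, ih _ _ _ hv', modTriple_s,
      Finset.sum_range_succ', pow_succ', map_mul, mul_w, modTriple_s]
    simp only [hv', pow_succ, Equiv.Perm.mul_apply, pow_zero, Equiv.Perm.one_apply]
    ring

/-- As `c` is a unit, `a - c * k` takes each value of `ZMod q` exactly once for `k < q`. -/
theorem sum_range_indicator {q : ℕ} [NeZero q] {c : ZMod q} (hc : IsUnit c) (a : ZMod q) :
    ∑ k ∈ Finset.range q, (if a - c * (k : ZMod q) = 0 then (1 : ℤ) else 0) = 1 := by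
  obtain ⟨u, rfl⟩ := hc
  have key : ∀ k : ℕ, (a - u * (k : ZMod q) = 0 ↔ (k : ZMod q) = ↑u⁻¹ * a) := by
    intro k
    rw [sub_eq_zero, Units.eq_inv_mul_iff_mul_eq, eq_comm]
  rw [Finset.sum_eq_single (↑u⁻¹ * a).val]
  · rw [if_pos]
    rw [key, ZMod.natCast_zmod_val]
  · intro k hk hne
    rw [if_neg]
    rw [key]
    intro h
    apply hne
    rw [← h, ZMod.val_cast_of_lt (Finset.mem_range.mp hk)]
  · intro h
    exact absurd (Finset.mem_range.mpr (ZMod.val_lt _)) h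

/-- The rotation of `Fin q`. -/
def finRotation (q : ℕ) [NeZero q] : Equiv.Perm (Fin q) :=
  ((ZMod.finEquiv q).toEquiv.trans (Equiv.addRight 1)).trans (ZMod.finEquiv q).toEquiv.symm

theorem finEquiv_rotation_pow {q : ℕ} [NeZero q] (m : ℕ) (x : Fin q) :
    ZMod.finEquiv q ((finRotation q ^ m) x) = ZMod.finEquiv q x + m := by
  induction m with
  | zero => simp
  | succ m ih =>
    rw [pow_succ', Equiv.Perm.mul_apply]
    have : ∀ y, ZMod.finEquiv q (finRotation q y) = ZMod.finEquiv q y + 1 := fun y =>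
      (ZMod.finEquiv q).apply_symm_apply _
    rw [this, ih]
    push_cast
    ring

theorem rotation_pow_self (q : ℕ) [NeZero q] : finRotation q ^ q = 1 := by
  ext x
  congr 1
  apply (ZMod.finEquiv q).injective
  rw [finEquiv_rotation_pow]
  simp

theorem finEquiv_rotation_inv_pow {q : ℕ} [NeZero q] (m : ℕ) (x : Fin q) :
    ZMod.finEquiv q (((finRotation q)⁻¹ ^ m) x) = ZMod.finEquiv q x - m := by
  rw [eq_sub_iff_add_eq, ← finEquiv_rotation_pow, inv_pow, ← Equiv.Perm.mul_apply,
    mul_inv_cancel, Equiv.Perm.one_apply]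

/-- For `q` prime to `6`, the rotation of `q` points lifts to an element of order `q`. -/
theorem exists_rotation_lift {q : ℕ} [NeZero q] (hq3 : 3 ≤ q) (hq : q.Coprime 6) :
    ∃ g : BraidModGammaThree q, g ^ q = 1 ∧ modPerm q g = finRotation q := by
  have hu2 : IsUnit (2 : ZMod q) := by
    have := (ZMod.isUnit_iff_coprime 2 q).mpr (Nat.Coprime.coprime_dvd_right ⟨3, rfl⟩ hq).symm
    exact_mod_cast this
  have hu3 : IsUnit (3 : ZMod q) := by
    have := (ZMod.isUnit_iff_coprime 3 q).mpr (Nat.Coprime.coprime_dvd_right ⟨2, rfl⟩ hq).symm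
    exact_mod_cast this
  let e := ZMod.finEquiv q
  obtain ⟨b, hb⟩ := modPerm_surjective q (finRotation q)
  have pow_mem : ∀ y, modPerm q y = finRotation q → y ^ q ∈ modPure q := fun y hy => by
    rw [mem_modPure, map_pow, hy, rotation_pow_self]
  have hbP := pow_mem b hb
  obtain ⟨v1, v2, -, -⟩ := modTriple_alternating (b ^ q)
  have vinv : ∀ (k : ℕ) i j, (modTriple q (b ^ q)).v (((finRotation q)⁻¹ ^ k) i)
      (((finRotation q)⁻¹ ^ k) j) = (modTriple q (b ^ q)).v i j := by
    intro k i j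
    have h1 : b ^ k * b ^ q * (b ^ k)⁻¹ = b ^ q := by
      rw [← pow_add, add_comm, pow_add, mul_inv_cancel_right]
    conv_rhs => rw [← h1]
    rw [map_mul, map_mul, map_inv, conj_v _ _ (modTriple_s_of_mem hbP), modTriple_s, map_pow (modPerm q), hb,
      inv_pow]
  -- The values of `b ^ q` are rotation invariant because `b` commutes with it. Rotating by `k`
  -- steps back changes `i + j` by `-2 * k`, so the condition `i + j = 0` selects one member of each
  -- rotation orbit of pairs; the correction there cancels the value on the whole orbit. The values
  -- are even because `b ^ q` is pure.
  obtain ⟨x, hx, hxv⟩ := exists_modPure_v_eq hq3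
    (fun i j => -(if e i + e j = 0 then (modTriple q (b ^ q)).v i j else 0))
    (fun i j => by simp only [add_comm (e i), v1 i j])
    (fun i => by simp only [v2, ite_self, neg_zero])
    (fun i j => by
      rw [Int.dvd_neg]
      split_ifs
      · by_cases hij : i = j
        · rw [hij, v2]; exact dvd_zero _
        · have := (modTriple_inversion (b ^ q)).1 i j hij
          rw [modTriple_s_of_mem hbP, inv_one, Equiv.Perm.one_apply, Equiv.Perm.one_apply,
            sub_self] at this
          exact_mod_cast (ZMod.intCast_zmod_eq_zero_iff_dvd _ 2).mp this
      · exact dvd_zero _)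
  have hy : modPerm q (x * b) = finRotation q := by rw [map_mul, mem_modPure.mp hx, one_mul, hb]
  have hyP := pow_mem _ hy
  have hyv : ∀ i j, (modTriple q ((x * b) ^ q)).v i j = 0 := by
    intro i j
    rw [modTriple_mul_pow_v hx, hb]
    simp only [hxv, vinv]
    have := sum_range_indicator hu2 (e i + e j)
    have h2 : ∀ k : ℕ, e (((finRotation q)⁻¹ ^ k) i) + e (((finRotation q)⁻¹ ^ k) j) =
        e i + e j - 2 * k := fun k => by
      rw [finEquiv_rotation_inv_pow, finEquiv_rotation_inv_pow]; ring
    simp only [h2]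
    rw [Finset.sum_neg_distrib, neg_add_eq_zero]
    conv_rhs => rw [← one_mul ((modTriple q (b ^ q)).v i j), ← this, Finset.sum_mul]
    simp
  have hyC := mem_commutator_of_v hq3 hyP hyv
  set y := x * b
  obtain ⟨-, -, w1, w2⟩ := modTriple_alternating (y ^ q)
  have winv : ∀ (l : ℕ) i j k, (modTriple q (y ^ q)).w (((finRotation q)⁻¹ ^ l) i)
      (((finRotation q)⁻¹ ^ l) j) (((finRotation q)⁻¹ ^ l) k) = (modTriple q (y ^ q)).w i j k := by
    intro l i j k
    have h1 : y ^ l * y ^ q * (y ^ l)⁻¹ = y ^ q := by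
      rw [← pow_add, add_comm, pow_add, mul_inv_cancel_right]
    conv_rhs => rw [← h1]
    rw [map_mul, map_mul, map_inv, conj_w _ _ (modTriple_s_of_mem hyP) hyv, modTriple_s, map_pow (modPerm q),
      hy, inv_pow]
  -- The same selection for triples: the sum changes by `-3 * l`. Divisibility by `24` holds because
  -- `y ^ q` now lies in the commutator subgroup.
  obtain ⟨z, hz, hzw⟩ := exists_commutator_w_eq hq3
    (fun i j k => -(if e i + e j + e k = 0 then (modTriple q (y ^ q)).w i j k else 0))
    (fun i j k => by
      simp only [add_comm (e i), w1 i j k]; split_ifs <;> simp)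
    (fun i j k => by
      simp only [add_right_comm (e i) (e j), w2 i j k]; split_ifs <;> simp)
    (fun i j k => by
      rw [Int.dvd_neg]
      split_ifs
      · exact dvd_modTriple_w hq3 hyC i j k
      · exact dvd_zero _)
  have hzy : modPerm q (z * y) = finRotation q := by
    rw [map_mul, mem_modPure.mp (commutator_le_modPure q hz), one_mul, hy]
  refine ⟨z * y, ?_, hzy⟩
  apply modTriple_injective hq3
  rw [map_one]
  ext i j k
  · rw [modTriple_mul_pow_v (commutator_le_modPure q hz), hyv]
    simp [modTriple_v_of_mem hz]
  · rw [modTriple_mul_pow_w hz, hy]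
    simp only [hzw, winv]
    have := sum_range_indicator hu3 (e i + e j + e k)
    have h2 : ∀ l : ℕ, e (((finRotation q)⁻¹ ^ l) i) + e (((finRotation q)⁻¹ ^ l) j) +
        e (((finRotation q)⁻¹ ^ l) k) = e i + e j + e k - 3 * l := fun l => by
      rw [finEquiv_rotation_inv_pow, finEquiv_rotation_inv_pow, finEquiv_rotation_inv_pow]; ring
    simp only [h2]
    rw [Finset.sum_neg_distrib, one_w, neg_add_eq_zero]
    conv_rhs => rw [← one_mul ((modTriple q (y ^ q)).w i j k), ← this, Finset.sum_mul]
    simp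
  · rw [modTriple_s_of_mem (pow_mem _ hzy)]; rfl

end Rotation

/-! ### Commuting blocks of consecutive strings. -/

section Blocks

variable {n q a : ℕ}

theorem blockHom_rels (h : a + q ≤ n) : ∀ r ∈ braidRels q,
    FreeGroup.lift (fun i : Fin (q - 1) => braidGen n (a + i)) r = 1 := by
  rintro r (⟨i, j, hij, rfl⟩ | ⟨i, j, hij, rfl⟩)
  · simp only [map_mul, map_inv, FreeGroup.lift_apply_of, mul_inv_eq_one]
    exact braidGen_comm (by omega) (by omega)
  · simp only [map_mul, map_inv, FreeGroup.lift_apply_of, mul_inv_eq_one, ← hij, ← add_assoc]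
    exact braidGen_braid (by omega)

/-- The braid group of a block of consecutive strings, inside the braid group. -/
def blockHom (h : a + q ≤ n) : BraidGroup q →* BraidGroup n :=
  PresentedGroup.toGroup (blockHom_rels h)

theorem blockHom_of (h : a + q ≤ n) (i : Fin (q - 1)) :
    blockHom h (PresentedGroup.of i) = braidGen n (a + i) := PresentedGroup.toGroup.of _

/-- A block of consecutive indices. -/
def blockEquiv (h : a + q ≤ n) : Fin q ≃ {y : Fin n // a ≤ y.val ∧ y.val < a + q} where
  toFun x := ⟨⟨a + x, by omega⟩, by simp⟩
  invFun y := ⟨y.1.val - a, by omega⟩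
  left_inv x := by simp
  right_inv y := by
    apply Subtype.ext
    apply Fin.ext
    simp only
    omega

/-- Permutations of a block of consecutive indices. -/
def blockPerm (h : a + q ≤ n) : Equiv.Perm (Fin q) →* Equiv.Perm (Fin n) :=
  Equiv.Perm.extendDomainHom (blockEquiv h)

theorem blockPerm_apply (h : a + q ≤ n) (p : Equiv.Perm (Fin q)) (x : Fin q) :
    blockPerm h p ⟨a + x, by omega⟩ = ⟨a + p x, by omega⟩ :=
  Equiv.Perm.extendDomain_apply_image p (blockEquiv h) x

theorem blockPerm_apply_of_not (h : a + q ≤ n) (p : Equiv.Perm (Fin q)) {y : Fin n}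
    (hy : ¬ (a ≤ y.val ∧ y.val < a + q)) : blockPerm h p y = y :=
  Equiv.Perm.extendDomain_apply_not_subtype p (blockEquiv h) hy

theorem braidPerm_blockHom (h : a + q ≤ n) (b : BraidGroup q) :
    braidPerm n (blockHom h b) = blockPerm h (braidPerm q b) := by
  have : (braidPerm n).comp (blockHom h) = (blockPerm h).comp (braidPerm q) := by
    refine PresentedGroup.ext fun i => ?_
    rw [MonoidHom.comp_apply, MonoidHom.comp_apply, blockHom_of, braidPerm_of,
      braidGen_eq (by omega), braidPerm_of]
    ext y
    rw [adjSwap_val]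
    by_cases hy : a ≤ y.val ∧ y.val < a + q
    · obtain ⟨x, hx⟩ : ∃ x : Fin q, y = ⟨a + x, by omega⟩ :=
        ⟨⟨y - a, by omega⟩, Fin.ext (by simp only; omega)⟩
      rw [hx, blockPerm_apply]
      simp only [adjSwap_val]
      split_ifs <;> omega
    · rw [blockPerm_apply_of_not h _ hy, if_neg (by simp only; omega),
        if_neg (by simp only; omega)]
  exact DFunLike.congr_fun this b

theorem gammaThreePure_le_comap_blockHom (h : a + q ≤ n) :
    gammaThreePure q ≤ (gammaThreePure n).comap (blockHom h) := by
  have hP : (pureBraidGroup q).map (blockHom h) ≤ pureBraidGroup n := by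
    rw [Subgroup.map_le_iff_le_comap]
    intro b hb
    rw [Subgroup.mem_comap, pureBraidGroup, MonoidHom.mem_ker, braidPerm_blockHom,
      MonoidHom.mem_ker.mp hb, map_one]
  rw [← Subgroup.map_le_iff_le_comap, gammaThreePure_eq, gammaThreePure_eq,
    Subgroup.map_commutator, Subgroup.map_commutator]
  exact Subgroup.commutator_mono (Subgroup.commutator_mono hP hP) hP

/-- The block homomorphism modulo `Γ_3` of the pure braid groups. -/
def modBlock (h : a + q ≤ n) : BraidModGammaThree q →* BraidModGammaThree n :=
  QuotientGroup.map _ _ (blockHom h) (gammaThreePure_le_comap_blockHom h)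

theorem modPerm_modBlock (h : a + q ≤ n) (g : BraidModGammaThree q) :
    modPerm n (modBlock h g) = blockPerm h (modPerm q g) := by
  obtain ⟨b, rfl⟩ := QuotientGroup.mk'_surjective _ g
  exact braidPerm_blockHom h b

theorem modBlock_mem_genSegment (h : a + q ≤ n) (g : BraidModGammaThree q) :
    modBlock h g ∈ genSegment (modGen n) a (a + q - 1) := by
  obtain ⟨b, rfl⟩ := QuotientGroup.mk'_surjective _ g
  have : (⊤ : Subgroup (BraidGroup q)) ≤ (genSegment (modGen n) a (a + q - 1)).comap
      ((modBlock h).comp (QuotientGroup.mk' _)) := by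
    rw [← PresentedGroup.closure_range_of, Subgroup.closure_le]
    rintro _ ⟨i, rfl⟩
    have e : (modBlock h).comp (QuotientGroup.mk' _) (PresentedGroup.of i) = modGen n (a + i) :=
      congrArg (QuotientGroup.mk' _) (blockHom_of h i)
    rw [SetLike.mem_coe, Subgroup.mem_comap, e]
    exact mem_genSegment _ (by omega) (by omega)
  exact this (Subgroup.mem_top b)

theorem modBlock_commute {q' a' : ℕ} (h : a + q ≤ n) (h' : a' + q' ≤ n) (haa : a + q ≤ a')
    (g : BraidModGammaThree q) (g' : BraidModGammaThree q') :
    Commute (modBlock h g) (modBlock h' g') := by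
  have hle : genSegment (modGen n) a (a + q - 1) ≤
      Subgroup.centralizer (genSegment (modGen n) a' (a' + q' - 1)) := by
    rw [genSegment, genSegment, Subgroup.centralizer_closure, Subgroup.closure_le]
    rintro _ ⟨i, hi, hi', rfl⟩
    rw [SetLike.mem_coe, Subgroup.mem_centralizer_iff]
    rintro _ ⟨j, hj, hj', rfl⟩
    exact (modGen_comm (by omega) (by omega)).symm
  exact (Subgroup.mem_centralizer_iff.mp (hle (modBlock_mem_genSegment h g)) _
    (modBlock_mem_genSegment h' g')).symm

/-- The homomorphism from a cyclic group given by an element of finite order. -/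
def cyclicHom {G : Type} [Group G] {q : ℕ} [NeZero q] (g : G) (hg : g ^ q = 1) :
    Multiplicative (ZMod q) →* G where
  toFun t := g ^ t.toAdd.val
  map_one' := by simp
  map_mul' s t := by
    rw [toAdd_mul, ZMod.val_add, ← pow_eq_pow_mod _ hg, pow_add]

/-- A product of cyclic groups of orders prime to `6` and of total order at most `n` embeds in
`B_n / Γ_3(P_n)`. -/
theorem exists_injective_of_sum_le {m : ℕ} (q : Fin m → ℕ) (hq1 : ∀ j, 1 < q j)
    (hq6 : ∀ j, (q j).Coprime 6) (hsum : ∑ j, q j ≤ n) :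
    ∃ f : (∀ j, Multiplicative (ZMod (q j))) →* BraidModGammaThree n, Function.Injective f := by
  have hq3 : ∀ j, 3 ≤ q j := by
    intro j
    have h1 := hq1 j
    have h2 := hq6 j
    by_contra hlt
    obtain h : q j = 2 := by omega
    rw [h] at h2
    exact absurd h2 (by decide)
  have inst : ∀ j, NeZero (q j) := fun j => ⟨by have := hq1 j; omega⟩
  -- Block `j` starts after all the earlier blocks, so the blocks are disjoint and consecutive.
  let a : Fin m → ℕ := fun j => ∑ l ∈ Finset.Iio j, q l
  have hadd : ∀ j, a j + q j = ∑ l ∈ Finset.Iic j, q l := by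
    intro j
    rw [← Finset.Iio_insert, Finset.sum_insert (by simp), add_comm]
  have ha : ∀ j, a j + q j ≤ n := by
    intro j
    rw [hadd]
    exact (Finset.sum_le_sum_of_subset (Finset.subset_univ _)).trans hsum
  have haa : ∀ i j, i < j → a i + q i ≤ a j := by
    intro i j hij
    rw [hadd]
    exact Finset.sum_le_sum_of_subset fun l hl =>
      Finset.mem_Iio.mpr ((Finset.mem_Iic.mp hl).trans_lt hij)
  choose g hg hgp using fun j => exists_rotation_lift (hq3 j) (hq6 j)
  let φ : ∀ j, Multiplicative (ZMod (q j)) →* BraidModGammaThree n := fun j =>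
    (modBlock (ha j)).comp (cyclicHom (g j) (hg j))
  have hcomm : Pairwise fun i j => ∀ x y, Commute (φ i x) (φ j y) := by
    intro i j hij x y
    rcases lt_or_gt_of_ne hij with h | h
    · exact modBlock_commute _ _ (haa i j h) _ _
    · exact (modBlock_commute _ _ (haa j i h) _ _).symm
  refine ⟨MonoidHom.noncommPiCoprod φ hcomm, ?_⟩
  have hφ : ∀ j t (x : Fin (q j)), modPerm n (φ j t) ⟨a j + x, by have := ha j; omega⟩ =
      ⟨a j + (modPerm (q j) (cyclicHom (g j) (hg j) t)) x, by have := ha j; omega⟩ := by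
    intro j t x
    change modPerm n (modBlock (ha j) _) _ = _
    rw [modPerm_modBlock]
    exact blockPerm_apply (ha j) _ x
  have hφ' : ∀ i j, i ≠ j → ∀ t (x : Fin (q j)),
      modPerm n (φ i t) ⟨a j + x, by have := ha j; omega⟩ =
        ⟨a j + x, by have := ha j; omega⟩ := by
    intro i j hij t x
    change modPerm n (modBlock (ha i) _) _ = _
    rw [modPerm_modBlock]
    refine blockPerm_apply_of_not (ha i) _ ?_
    rcases lt_or_gt_of_ne hij with h | h
    · have := haa i j h
      simp only
      omega
    · have := haa j i h
      simp only
      omega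
  -- On block `j` only the factor with index `j` moves anything.
  have key : ∀ t : ∀ j, Multiplicative (ZMod (q j)), ∀ j (x : Fin (q j)),
      modPerm n (MonoidHom.noncommPiCoprod φ hcomm t) ⟨a j + x, by have := ha j; omega⟩ =
        modPerm n (φ j (t j)) ⟨a j + x, by have := ha j; omega⟩ := by
    intro t
    rw [← Finset.univ_prod_mulSingle t]
    refine Finset.prod_induction _ (fun t => ∀ j (x : Fin (q j)),
      modPerm n (MonoidHom.noncommPiCoprod φ hcomm t) ⟨a j + x, by have := ha j; omega⟩ =
        modPerm n (φ j (t j)) ⟨a j + x, by have := ha j; omega⟩) ?_ ?_ ?_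
    · intro s t hs ht j x
      rw [map_mul, map_mul, Equiv.Perm.mul_apply, ht j x, hφ, hs, Pi.mul_apply, map_mul, map_mul,
        Equiv.Perm.mul_apply, hφ j (t j)]
    · intro j x
      simp
    · intro i _ j x
      rw [MonoidHom.noncommPiCoprod_mulSingle]
      by_cases hij : i = j
      · subst hij
        rw [Pi.mulSingle_eq_same]
      · rw [hφ' i j hij, Pi.mulSingle_eq_of_ne (Ne.symm hij)]
        simp
  rw [injective_iff_map_eq_one]
  intro t ht
  funext j
  -- The image of the first point of block `j` recovers the component `t j`, since a rotation by `t`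
  -- steps sends `0` to `t`.
  have h0 := key t j 0
  rw [ht, map_one, Equiv.Perm.one_apply, hφ, Fin.ext_iff] at h0
  have h1 : (finRotation (q j) ^ (t j).toAdd.val) 0 = 0 := by
    have : modPerm (q j) (cyclicHom (g j) (hg j) (t j)) = finRotation (q j) ^ (t j).toAdd.val := by
      change modPerm (q j) (g j ^ _) = _
      rw [map_pow, hgp]
    rw [← this]
    exact Fin.ext (Nat.add_left_cancel h0).symm
  have h2 := finEquiv_rotation_pow (t j).toAdd.val (0 : Fin (q j))
  rw [h1, ZMod.natCast_zmod_val, left_eq_add] at h2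
  exact h2

end Blocks

/-! ### Commutative permutation groups inside products of cyclic groups. -/

section AbelianPermutations

/-- A sum of integers greater than `1` is at most their product. -/
theorem sum_le_prod_of_one_lt {ι : Type} (s : Finset ι) (f : ι → ℕ) (hf : ∀ i, 1 < f i) :
    ∑ i ∈ s, f i ≤ ∏ i ∈ s, f i := by
  classical
  induction s using Finset.induction_on with
  | empty => simp
  | insert i s hi ih =>
    rw [Finset.sum_insert hi, Finset.prod_insert hi]
    rcases s.eq_empty_or_nonempty with rfl | ⟨j, hj⟩
    · simp
    · have h1 := hf i
      have h2 : 2 ≤ ∏ k ∈ s, f k :=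
        (hf j).trans_le (Finset.single_le_prod' (fun k _ => (hf k).le) hj)
      nlinarith

/-- A commutative permutation group embeds in a product of cyclic groups of total order at most
the degree. -/
theorem exists_injective_prod_cyclic {n : ℕ} (K : Subgroup (Equiv.Perm (Fin n)))
    [IsMulCommutative K] : ∃ (m : ℕ) (q : Fin m → ℕ), (∀ j, 1 < q j) ∧
      (∀ j, q j ∣ Nat.card K) ∧ ∑ j, q j ≤ n ∧
      ∃ f : K →* (∀ j, Multiplicative (ZMod (q j))), Function.Injective f := by
  classical
  let _ : CommGroup K := { (inferInstance : Group K) with mul_comm := mul_comm' }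
  let Ω := MulAction.orbitRel.Quotient K (Fin n)
  let S : Ω → Subgroup K := fun o => MulAction.stabilizer K o.out
  have hdec := fun o : Ω => CommGroup.equiv_prod_multiplicative_zmod_of_finite (K ⧸ S o)
  choose ι hι c hc e using hdec
  have hcard : ∀ o, Nat.card (K ⧸ S o) = ∏ i, c o i := by
    intro o
    rw [Nat.card_congr (e o).some.toEquiv, Nat.card_pi]
    exact Finset.prod_congr rfl fun i _ => Nat.card_zmod _
  let J := Σ o : Ω, ι o
  let E : J ≃ Fin (Fintype.card J) := Fintype.equivFin J
  let q : J → ℕ := fun j => c j.1 j.2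
  refine ⟨Fintype.card J, fun j => q (E.symm j), fun j => hc _ _, fun j => ?_, ?_, ?_⟩
  · refine dvd_trans ?_ (Subgroup.card_quotient_dvd_card (S (E.symm j).1))
    rw [hcard]
    exact Finset.dvd_prod_of_mem _ (Finset.mem_univ _)
  · rw [E.symm.sum_comp q, Fintype.sum_sigma]
    -- The product over the cyclic factors of one orbit is the size of that orbit, and the orbit
    -- sizes add up to `n`.
    calc ∑ o, ∑ i, c o i ≤ ∑ o, ∏ i, c o i :=
          Finset.sum_le_sum fun o _ => sum_le_prod_of_one_lt _ _ (hc o)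
      _ = ∑ o, Nat.card (K ⧸ S o) := Finset.sum_congr rfl fun o _ => (hcard o).symm
      _ = Nat.card (Σ o : Ω, K ⧸ S o) := Nat.card_sigma.symm
      _ = Nat.card (Fin n) :=
          (Nat.card_congr (MulAction.selfEquivSigmaOrbitsQuotientStabilizer K (Fin n))).symm
      _ = n := Nat.card_fin n
      _ ≤ n := le_rfl
  · refine ⟨MonoidHom.pi fun j => (Pi.evalMonoidHom _ (E.symm j).2).comp
      ((e (E.symm j).1).some.toMonoidHom.comp (QuotientGroup.mk' (S (E.symm j).1))), ?_⟩
    rw [injective_iff_map_eq_one]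
    intro k hk
    have hJ : ∀ j : J, (e j.1).some (QuotientGroup.mk' (S j.1) k) j.2 = 1 :=
      E.symm.surjective.forall.mpr fun j => congrFun hk j
    have hS : ∀ o, k ∈ S o := by
      intro o
      rw [← QuotientGroup.eq_one_iff, ← (e o).some.map_eq_one_iff]
      exact funext fun i => hJ ⟨o, i⟩
    apply Subtype.ext
    ext x
    congr 1
    -- In a commutative group all points of an orbit have the same stabilizer, so an element in the
    -- stabilizers of the chosen representatives fixes every point.
    obtain ⟨h, hh⟩ : ∃ h : K, h • x = (Quotient.mk'' x : Ω).out :=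
      MulAction.orbitRel_apply.mp (Quotient.exact' (Quotient.out_eq' (Quotient.mk'' x : Ω)))
    have h1 : k • h • x = h • x := by
      rw [hh]
      exact hS (Quotient.mk'' x)
    rw [smul_smul, mul_comm, ← smul_smul] at h1
    exact MulAction.injective h h1

end AbelianPermutations

/-! ### Finite subgroups of the quotient and the bijection of classes. -/

section Main

variable {n : ℕ}

/-- An element of the kernel is pure and of finite order, hence trivial. -/
theorem modPerm_subgroupMap_injective (hn : 3 ≤ n) (H : Subgroup (BraidModGammaThree n)) [Finite H] :
    Function.Injective ((modPerm n).subgroupMap H) := by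
  rw [injective_iff_map_eq_one]
  intro h hh
  have h1 : h.1 ∈ modPure n := mem_modPure.mpr (congrArg Subtype.val hh)
  refine Subtype.ext (eq_one_of_mem_modPure_of_pow hn h1 (Nat.card_pos (α := H)).ne' ?_)
  exact congrArg Subtype.val (pow_card_eq_one' (x := h))

/-- A finite subgroup of `B_n / Γ_3(P_n)` is isomorphic to its image in the symmetric group. -/
theorem nonempty_mulEquiv_map (hn : 3 ≤ n) (H : Subgroup (BraidModGammaThree n)) [Finite H] :
    Nonempty (H ≃* H.map (modPerm n)) :=
  ⟨MulEquiv.ofBijective ((modPerm n).subgroupMap H)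
    ⟨modPerm_subgroupMap_injective hn H, (modPerm n).subgroupMap_surjective H⟩⟩

/-- A finite subgroup of `B_n / Γ_3(P_n)` has order prime to `6`. -/
theorem coprime_card_six (hn : 3 ≤ n) (H : Subgroup (BraidModGammaThree n)) [Finite H] :
    (Nat.card H).Coprime 6 := by
  -- By Cauchy, a prime divisor of the order would give an element of that order.
  have key : ∀ p, p.Prime → (∀ g : BraidModGammaThree n, g ^ p = 1 → g = 1) →
      (Nat.card H).Coprime p := by
    intro p hp hg
    rw [Nat.coprime_comm, hp.coprime_iff_not_dvd]
    intro hdvd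
    have : Fact p.Prime := ⟨hp⟩
    obtain ⟨h, hh⟩ := exists_prime_orderOf_dvd_card' p hdvd
    have h1 : h.1 = 1 := hg h.1 (congrArg Subtype.val (hh ▸ pow_orderOf_eq_one h : h ^ p = 1))
    have h2 : h = 1 := Subtype.ext h1
    rw [h2, orderOf_one] at hh
    exact hp.one_lt.ne hh
  exact Nat.Coprime.mul_right (key 2 Nat.prime_two fun g => eq_one_of_sq_eq_one hn)
    (key 3 Nat.prime_three fun g => eq_one_of_cube_eq_one hn)

theorem image_property (hn : 3 ≤ n) {H : Subgroup (BraidModGammaThree n)}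
    (hH : IsFiniteAbelian H) :
    IsFiniteAbelian (H.map (modPerm n)) ∧ (Nat.card (H.map (modPerm n))).Coprime 6 := by
  obtain ⟨h1, h2⟩ := hH
  refine ⟨⟨inferInstance, inferInstance⟩, ?_⟩
  rw [← Nat.card_congr (nonempty_mulEquiv_map hn H).some.toEquiv]
  exact coprime_card_six hn H

/-- Every commutative permutation group of order prime to `6` is isomorphic to a finite Abelian
subgroup of `B_n / Γ_3(P_n)`. -/
theorem exists_isFiniteAbelian_mulEquiv {K : Subgroup (Equiv.Perm (Fin n))}
    (hK : IsFiniteAbelian K) (hK6 : (Nat.card K).Coprime 6) :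
    ∃ H : Subgroup (BraidModGammaThree n), IsFiniteAbelian H ∧ Nonempty (H ≃* K) := by
  obtain ⟨h1, h2⟩ := hK
  obtain ⟨m, q, hq1, hqd, hsum, f, hf⟩ := exists_injective_prod_cyclic K
  obtain ⟨φ, hφ⟩ := exists_injective_of_sum_le q hq1
    (fun j => Nat.Coprime.coprime_dvd_left (hqd j) hK6) hsum
  let ψ := φ.comp f
  let e : K ≃* ψ.range := MonoidHom.ofInjective (hφ.comp hf)
  refine ⟨ψ.range, ⟨Finite.of_equiv K e.toEquiv, ⟨⟨fun x y => ?_⟩⟩⟩, ⟨e.symm⟩⟩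
  obtain ⟨a, rfl⟩ := e.surjective x
  obtain ⟨b, rfl⟩ := e.surjective y
  rw [← map_mul, mul_comm', map_mul]

theorem subgroupIsoClass_eq_iff {G : Type} [Group G] {p : Subgroup G → Prop}
    {H K : {H : Subgroup G // p H}} :
    subgroupIsoClass H = subgroupIsoClass K ↔ Nonempty (H.1 ≃* K.1) :=
  Quotient.eq (r := subgroupIsoSetoid p)

end Main

theorem mainTheorem6 (n : ℕ) (hn : 3 ≤ n) :
    ∃ e : SubgroupIsoClasses
            (fun H : Subgroup (BraidModGammaThree n) => IsFiniteAbelian H) ≃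
          SubgroupIsoClasses
            (fun K : Subgroup (Equiv.Perm (Fin n)) =>
              IsFiniteAbelian K ∧ (Nat.card K).Coprime 6),
      ∀ (H : {H : Subgroup (BraidModGammaThree n) // IsFiniteAbelian H})
        (K : {K : Subgroup (Equiv.Perm (Fin n)) //
              IsFiniteAbelian K ∧ (Nat.card K).Coprime 6}),
        e (subgroupIsoClass H) = subgroupIsoClass K ↔ Nonempty (H.1 ≃* K.1) := by
  let im (H : {H : Subgroup (BraidModGammaThree n) // IsFiniteAbelian H}) :
      {K : Subgroup (Equiv.Perm (Fin n)) // IsFiniteAbelian K ∧ (Nat.card K).Coprime 6} :=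
    ⟨H.1.map (modPerm n), image_property hn H.2⟩
  have him : ∀ H, Nonempty (H.1 ≃* (im H).1) := fun H =>
    have := H.2.1
    nonempty_mulEquiv_map hn H.1
  let F : SubgroupIsoClasses (fun H : Subgroup (BraidModGammaThree n) => IsFiniteAbelian H) →
      SubgroupIsoClasses (fun K : Subgroup (Equiv.Perm (Fin n)) =>
        IsFiniteAbelian K ∧ (Nat.card K).Coprime 6) :=
    Quotient.lift (fun H => subgroupIsoClass (im H)) fun H H' ⟨f⟩ =>
      subgroupIsoClass_eq_iff.mpr ⟨((him H).some.symm.trans f).trans (him H').some⟩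
  have hF : ∀ H K, F (subgroupIsoClass H) = subgroupIsoClass K ↔ Nonempty (H.1 ≃* K.1) := by
    intro H K
    refine Iff.trans (subgroupIsoClass_eq_iff (H := im H) (K := K)) ⟨fun ⟨f⟩ => ?_, fun ⟨f⟩ => ?_⟩
    · exact ⟨(him H).some.trans f⟩
    · exact ⟨(him H).some.symm.trans f⟩
  have hbij : Function.Bijective F := by
    constructor
    · rintro ⟨H⟩ ⟨H'⟩ h
      obtain ⟨f⟩ := (hF H (im H')).mp h
      exact subgroupIsoClass_eq_iff.mpr ⟨f.trans (him H').some.symm⟩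
    · rintro ⟨K⟩
      obtain ⟨H, hH, hHK⟩ := exists_isFiniteAbelian_mulEquiv K.2.1 K.2.2
      exact ⟨subgroupIsoClass ⟨H, hH⟩, (hF ⟨H, hH⟩ K).mpr hHK⟩
  exact ⟨Equiv.ofBijective F hbij, hF⟩
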